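/- Let $1\le d\le D$ be integers. A closed set $M\subset\mathbb R^D$ is a $d$-dimensional $C^2$-submanifold with boundary if each $p\in M$ has an open neighborhood $V\subset\mathbb R^D$ for which there are an open neighborhood $U$ of $0$ in $\mathbb R^D$ and a $C^2$-diffeomorphism $\Psi:U\to V$ with $\Psi(0)=p$ such that either $\Psi(U\cap(\mathbb R^d\times\{0\}^{D-d}))=M\cap V$ or $\Psi(U\cap(\mathbb R^{d-1}\times\mathbb R_+\times\{0\}^{D-d}))=M\cap V$; the points of the second kind form the boundary $\partial M$. The reach of a closed set $S\subset\mathbb R^D$ is $\tau_S=\inf\{\mathrm d(z,S): z \text{ has at least two nearest neighbors on } S\}\in[0,\infty]$ (with $\inf\emptyset=\infty$). For $\tau_{\min}\in(0,\infty]$, $\tau_{\partial,\min}\in(0,\infty)$ and $0<f_{\min}\le f_{\max}<\infty$, let $\mathcal P=\mathcal P^{d,D}_{\tau_{\min},\tau_{\partial,\min}}(f_{\min},f_{\max})$ be the set of Borel probability distributions $P$ on $\mathbb R^D$ whose support $M=\mathrm{Supp}(P)$ is a compact connected $d$-dimensional $C^2$-submanifold with (possibly empty) boundary such that $\tau_M\ge\tau_{\min}$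 and $\tau_{\partial M}\ge\tau_{\partial,\min}$, and which have a density $f$ with respect to the restriction to $M$ of the $d$-dimensional Hausdorff measure $\mathcal H^d$ (normalized to be the Lebesgue measure if $d=D$) such that $f_{\min}\le f(x)\le f_{\max}$ for all $x\in M$. Let $\mathrm d_H$ denote the Hausdorff distance, with values in $[0,\infty]$. **Theorem.** For every integer $d\ge1$ there are constants $c_d,c'_d,C_d>0$, depending only on $d$, such that the following holds for all $D\ge d$, all $\tau_{\min}\in(0,\infty]$, $\tau_{\partial,\min}\in(0,\infty)$ and all $0<f_{\min}\le f_{\max}<\infty$ with $f_{\min}\le c_d/\tau_{\partial,\min}^d$ and $c'_d/\tau_{\partial,\min}^d\le f_{\max}$: for all $n\ge1$, $$\inf_{\hat B_n}\ \sup_{\substack{P\in\mathcal P\\ \partial M\ne\emptyset}}\mathbb E_{P^n}\bigl[\mathrm d_H(\partial M,\hat B_n)\bigr]\ \ge\ C_d\,\tau_{\partial,\min}\left\{1\wedge\left(\frac{1}{f_{\min}\,\tau_{\partial,\min}^d\,n}\right)^{2/(d+1)}\right\},$$ where $M=\mathrm{Supp}(P)$ and the infimum ranges over all estimators $\hat B_n=\hat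 B_n(X_1,\dots,X_n)$, that is, over all maps from $(\mathbb R^D)^n$ to the subsets of $\mathbb R^D$ such that $\mathrm d_H(K,\hat B_n)$ is a measurable function of the observations for every nonempty compact $K\subset\mathbb R^D$. -/

import Mathlib

open MeasureTheory Set
open scoped ENNReal Topology

namespace BoundaryEstimation

noncomputable section

/-- The subspace `ℝ^d × {0}^(D-d)` of `ℝ^D`. -/
def flat (d D : ℕ) : Set (EuclideanSpace ℝ (Fin D)) :=
  {x | ∀ i : Fin D, d ≤ (i : ℕ) → x i = 0}

/-- The half-space `ℝ^(d-1) × ℝ_+ × {0}^(D-d)` of `ℝ^D` (for `1 ≤ d ≤ D`): the `d`-th coordinate,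
which has index `d - 1` in `Fin D`, is nonnegative. -/
def halfFlat (d D : ℕ) : Set (EuclideanSpace ℝ (Fin D)) :=
  {x | x ∈ flat d D ∧ ∀ i : Fin D, (i : ℕ) + 1 = d → 0 ≤ x i}

/-- There is a `C²`-diffeomorphism `Ψ` between an open neighborhood `U` of `0` (its source) and an
open neighborhood `V` of `p` (its target), with `Ψ 0 = p`, which maps `U ∩ L` onto `M ∩ V`.
By restriction of `Ψ`, the same then holds for every smaller open neighborhood of `p`. -/
def HasChart {D : ℕ} (L M : Set (EuclideanSpace ℝ (Fin D))) (p : EuclideanSpace ℝ (Fin D)) :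
    Prop :=
  ∃ Ψ : OpenPartialHomeomorph (EuclideanSpace ℝ (Fin D)) (EuclideanSpace ℝ (Fin D)),
    0 ∈ Ψ.source ∧ Ψ 0 = p ∧
    ContDiffOn ℝ 2 Ψ Ψ.source ∧ ContDiffOn ℝ 2 Ψ.symm Ψ.target ∧
    Ψ '' (Ψ.source ∩ L) = M ∩ Ψ.target

/-- The interior points of `M`, seen as a `d`-dimensional submanifold with boundary. -/
def interiorPoints {D : ℕ} (d : ℕ) (M : Set (EuclideanSpace ℝ (Fin D))) :
    Set (EuclideanSpace ℝ (Fin D)) :=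
  {p | p ∈ M ∧ HasChart (flat d D) M p}

/-- The (differential) boundary `∂M` of `M`, seen as a `d`-dimensional submanifold with
boundary. -/
def boundary {D : ℕ} (d : ℕ) (M : Set (EuclideanSpace ℝ (Fin D))) :
    Set (EuclideanSpace ℝ (Fin D)) :=
  {p | p ∈ M ∧ HasChart (halfFlat d D) M p}

/-- `M` is a `d`-dimensional `C²`-submanifold of `ℝ^D` with (possibly empty) boundary. -/
def IsSubmanifoldWithBoundary {D : ℕ} (d : ℕ) (M : Set (EuclideanSpace ℝ (Fin D))) : Prop :=
  IsClosed M ∧ ∀ p ∈ M, p ∈ interiorPoints d M ∨ p ∈ boundary d M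

/-- The medial axis: the points that have at least two nearest neighbors on `S`. -/
def medialAxis {D : ℕ} (S : Set (EuclideanSpace ℝ (Fin D))) : Set (EuclideanSpace ℝ (Fin D)) :=
  {z | ∃ x ∈ S, ∃ y ∈ S, x ≠ y ∧ dist z x = Metric.infDist z S ∧ dist z y = Metric.infDist z S}

/-- The reach `τ_S = inf_{z ∈ Med(S)} d(z, S)`, with value `∞` if the medial axis is empty. -/
def reach {D : ℕ} (S : Set (EuclideanSpace ℝ (Fin D))) : ℝ≥0∞ :=
  ⨅ z ∈ medialAxis S, Metric.infEDist z S

/-- The geometric model: compact connected `d`-dimensional `C²`-submanifolds of `ℝ^D` with boundary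
such that `τ_M ≥ τmin` and `τ_{∂M} ≥ τbd`. -/
def geometricModel (d D : ℕ) (τmin τbd : ℝ≥0∞) : Set (Set (EuclideanSpace ℝ (Fin D))) :=
  {M | IsCompact M ∧ IsConnected M ∧ IsSubmanifoldWithBoundary d M ∧
    τmin ≤ reach M ∧ τbd ≤ reach (boundary d M)}

/-- The `d`-dimensional Hausdorff measure on `ℝ^D`, with the usual normalization
`2^(-d) vol(B(0,1)) ∑ diam(S_i)^d` (so that it is the Lebesgue measure if `d = D`). Mathlib's
`Measure.hausdorffMeasure` uses `∑ diam(S_i)^d`. -/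
def hausdorffVolume (d D : ℕ) : Measure (EuclideanSpace ℝ (Fin D)) :=
  (volume (Metric.ball (0 : EuclideanSpace ℝ (Fin d)) 1) / 2 ^ d) • Measure.hausdorffMeasure (d : ℝ)

/-- The statistical model: Borel probability distributions on `ℝ^D` whose support `M` lies in the
geometric model and which have a density with respect to `1_M 𝓗^d` with values in
`[fmin, fmax]` on `M`. -/
def statisticalModel (d D : ℕ) (τmin τbd : ℝ≥0∞) (fmin fmax : ℝ) :
    Set (Measure (EuclideanSpace ℝ (Fin D))) :=
  {P | IsProbabilityMeasure P ∧ P.support ∈ geometricModel d D τmin τbd ∧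
    ∃ f : EuclideanSpace ℝ (Fin D) → ℝ, Measurable f ∧
      (∀ x ∈ P.support, fmin ≤ f x ∧ f x ≤ fmax) ∧
      P = ((hausdorffVolume d D).restrict P.support).withDensity (fun x => ENNReal.ofReal (f x))}

/-- A (set-valued) estimator based on `n` observations: a map from `(ℝ^D)^n` to the subsets of
`ℝ^D`, which is measurable in the sense that its Hausdorff distance to any fixed nonempty compact
set is a measurable function of the observations. -/
def IsEstimator {D n : ℕ}
    (B : (Fin n → EuclideanSpace ℝ (Fin D)) → Set (EuclideanSpace ℝ (Fin D))) : Prop :=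
  ∀ K : Set (EuclideanSpace ℝ (Fin D)), IsCompact K → K.Nonempty →
    Measurable (fun x => Metric.hausdorffEDist K (B x))

/-- The expected Hausdorff loss `E_{P^n} [d_H(∂M, B(X_1, …, X_n))]`, `M = Supp(P)`, of the
estimator `B`. -/
def boundaryRisk {D n : ℕ} (d : ℕ) (P : Measure (EuclideanSpace ℝ (Fin D)))
    (B : (Fin n → EuclideanSpace ℝ (Fin D)) → Set (EuclideanSpace ℝ (Fin D))) : ℝ≥0∞ :=
  ∫⁻ x, Metric.hausdorffEDist (boundary d P.support) (B x) ∂(Measure.pi fun _ : Fin n => P)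

/-- The minimax risk for the estimation of `∂M` from `n` observations, over those distributions
of the statistical model whose support has nonempty boundary. -/
def boundaryMinimaxRisk (d D n : ℕ) (τmin τbd : ℝ≥0∞) (fmin fmax : ℝ) : ℝ≥0∞ :=
  ⨅ (B : (Fin n → EuclideanSpace ℝ (Fin D)) → Set (EuclideanSpace ℝ (Fin D)))
    (_ : IsEstimator B),
    ⨆ (P : Measure (EuclideanSpace ℝ (Fin D)))
      (_ : P ∈ statisticalModel d D τmin τbd fmin fmax)
      (_ : (boundary d P.support).Nonempty),
      boundaryRisk d P B

end

end BoundaryEstimation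

/-!
The lower bound is Le Cam's two-point bound, for a ball and the same ball with a small cap removed.

*The bodies.* Inside the flat `ℝ^d × {0}`, let `M₀` be the ball `|x|² ≤ R²` with `R = 2 τ_∂`, and
let `M₁ ⊆ M₀` be the sublevel set `φ ≤ R²` of `φ x = |x|² + η s² b ((x - a) / s)`, where `b` is a `C²`
bump, `|a| = R` and `s = t R` with `t ≤ 1` (`bumpedSq`). The scaling of the bump is such that, if
`η` is a small constant, then uniformly in `s` the function `φ` is convex and exceeds its tangents by at
most `3 |y - x|² / 2` (`IsRollingSublevel`). Hence `M₁` is convex, so its reach is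
infinite and every `τ_min` is allowed,
and a ball of radius `R / 2` rolls freely inside it, so the reach of the level set `φ = R²` is at
least `τ_∂` (`IsRollingSublevel.le_reach_shell`). The level set is the differential boundary of `M₁`
(`IsRollingSublevel.boundary_body`): at its points the inverse function theorem gives a
half-flat chart, and the points with `φ < R²` have none. The ball `M₀` is the case `η = 0`.

*The distributions.* `P₀` has density `f_min` on `M₀`, increased on a smaller ball opposite to the
bump so that the total mass is one; here the conditions on `f_min` and `f_max` enter. `P₁` is `P₀`
conditioned on `M₁`. The removed cap lies in a box of volume of order `R^d t^(d+1)`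
(`exists_hausdorffVolume_box_le`), so a suitable `t` of order `1 ∧ (1 / (f_min τ_∂^d n))^(1/(d+1))`
makes its mass at most `1 / (2 n)`. Then `P₀^n ≥ P₀(M₁)^n P₁^n ≥ P₁^n / 2`
(`pow_smul_pi_cond_le`), and no estimator can be close to both boundaries. These are at a Hausdorff
distance of order `t² R`, since the point `a` of the first sphere has at least this distance to `M₁`
(`le_edist_of_mem_body`).
-/

namespace BoundaryEstimation

open scoped InnerProductSpace

/-! ### Flats and convex bodies -/

/-- The set `flat d D` as a linear subspace. -/
def flatSubmodule (d D : ℕ) : Submodule ℝ (EuclideanSpace ℝ (Fin D)) where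
  carrier := flat d D
  add_mem' := fun {x y} hx hy i hi => by
    simp [hx i hi, hy i hi]
  zero_mem' := fun i _ => by simp
  smul_mem' := fun a x hx i hi => by simp [hx i hi]

theorem isClosed_flat (d D : ℕ) : IsClosed (flat d D) :=
  (flatSubmodule d D).closed_of_finiteDimensional

theorem norm_sub_midpoint_sq {E : Type*} [NormedAddCommGroup E] [InnerProductSpace ℝ E]
    {z x y : E} {r : ℝ} (hx : ‖z - x‖ = r) (hy : ‖z - y‖ = r) :
    ‖z - ((1 / 2 : ℝ) • x + (1 / 2 : ℝ) • y)‖ ^ 2 = r ^ 2 - ‖x - y‖ ^ 2 / 4 := by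
  have h1 : z - ((1 / 2 : ℝ) • x + (1 / 2 : ℝ) • y) = (1 / 2 : ℝ) • ((z - x) + (z - y)) := by
    module
  have h2 : x - y = (z - y) - (z - x) := by abel
  have h3 := parallelogram_law_with_norm ℝ (z - y) (z - x)
  rw [← h2, hx, hy, add_comm (z - y)] at h3
  rw [h1, norm_smul, mul_pow]
  norm_num
  linarith

theorem medialAxis_eq_empty_of_convex {D : ℕ} {S : Set (EuclideanSpace ℝ (Fin D))}
    (hS : Convex ℝ S) : medialAxis S = ∅ := by
  ext z
  simp only [medialAxis, mem_ofPred_eq, mem_empty_iff_false, iff_false]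
  rintro ⟨x, hx, y, hy, hxy, hzx, hzy⟩
  have hm := hS hx hy (by norm_num : (0 : ℝ) ≤ 1 / 2) (by norm_num : (0 : ℝ) ≤ 1 / 2)
    (by norm_num)
  have h1 := Metric.infDist_le_dist_of_mem (x := z) hm
  rw [dist_eq_norm] at hzx hzy h1
  have h2 := norm_sub_midpoint_sq hzx hzy
  have h3 : 0 < ‖x - y‖ := norm_pos_iff.2 (sub_ne_zero.2 hxy)
  have h4 := pow_le_pow_left₀ Metric.infDist_nonneg h1 2
  nlinarith

theorem reach_eq_top_of_convex {D : ℕ} {S : Set (EuclideanSpace ℝ (Fin D))}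
    (hS : Convex ℝ S) : reach S = ⊤ := by
  simp [reach, medialAxis_eq_empty_of_convex hS]

/-- The data of a uniformly smooth convex function `φ` with gradient field `G`, whose sublevel set
at height `c` meets the flat in a convex body. The quadratic upper bound together with the lower
bound on `‖G x‖` makes a ball of radius `ρ` roll freely inside this body. -/
structure IsRollingSublevel (d : ℕ) {D : ℕ} (φ : EuclideanSpace ℝ (Fin D) → ℝ)
    (G : EuclideanSpace ℝ (Fin D) → EuclideanSpace ℝ (Fin D)) (c ρ : ℝ) : Prop where
  contDiff : ContDiff ℝ 2 φ
  hasGradientAt : ∀ x, HasGradientAt φ (G x) x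
  gradient_mem : ∀ x ∈ flat d D, G x ∈ flat d D
  tangent_le : ∀ x y, φ x + ⟪G x, y - x⟫_ℝ ≤ φ y
  le_quadratic : ∀ x y, φ y ≤ φ x + ⟪G x, y - x⟫_ℝ + 3 / 2 * ‖y - x‖ ^ 2
  radius_pos : 0 < ρ
  radius_le : ∀ x ∈ flat d D, φ x = c → 3 * ρ ≤ ‖G x‖
  zero_lt : φ 0 < c
  bounded : ∃ R, ∀ x, φ x ≤ c → ‖x‖ ≤ R

/-- The part of the flat where `φ ≤ c`. -/
def body (d : ℕ) {D : ℕ} (φ : EuclideanSpace ℝ (Fin D) → ℝ) (c : ℝ) :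
    Set (EuclideanSpace ℝ (Fin D)) :=
  {x | x ∈ flat d D ∧ φ x ≤ c}

/-- The part of the flat where `φ = c`. -/
def shell (d : ℕ) {D : ℕ} (φ : EuclideanSpace ℝ (Fin D) → ℝ) (c : ℝ) :
    Set (EuclideanSpace ℝ (Fin D)) :=
  {x | x ∈ flat d D ∧ φ x = c}

namespace IsRollingSublevel

variable {d D : ℕ} {φ : EuclideanSpace ℝ (Fin D) → ℝ}
  {G : EuclideanSpace ℝ (Fin D) → EuclideanSpace ℝ (Fin D)} {c ρ : ℝ}

theorem continuous (h : IsRollingSublevel d φ G c ρ) : Continuous φ := h.contDiff.continuous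

theorem convexOn (h : IsRollingSublevel d φ G c ρ) : ConvexOn ℝ univ φ := by
  refine ⟨convex_univ, fun x _ y _ a b ha hb hab => ?_⟩
  set z := a • x + b • y with hz
  have h1 := mul_le_mul_of_nonneg_left (h.tangent_le z x) ha
  have h2 := mul_le_mul_of_nonneg_left (h.tangent_le z y) hb
  have h3 : a * ⟪G z, x - z⟫_ℝ + b * ⟪G z, y - z⟫_ℝ = 0 := by
    rw [← real_inner_smul_right, ← real_inner_smul_right, ← inner_add_right]
    have : a • (x - z) + b • (y - z) = 0 := by
      rw [smul_sub, smul_sub, sub_add_sub_comm, ← add_smul, hab, one_smul, sub_self]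
    rw [this, inner_zero_right]
  have h4 : a * φ z + b * φ z = φ z := by rw [← add_mul, hab, one_mul]
  simp only [smul_eq_mul]
  linarith

theorem convex_body (h : IsRollingSublevel d φ G c ρ) : Convex ℝ (body d φ c) := by
  intro x hx y hy a b ha hb hab
  have h1 := h.convexOn.convex_le c ⟨mem_univ x, hx.2⟩ ⟨mem_univ y, hy.2⟩ ha hb hab
  exact ⟨(flatSubmodule d D).convex hx.1 hy.1 ha hb hab, h1.2⟩

theorem isClosed_body (h : IsRollingSublevel d φ G c ρ) : IsClosed (body d φ c) :=
  (isClosed_flat d D).inter (isClosed_le h.continuous continuous_const)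

theorem isClosed_shell (h : IsRollingSublevel d φ G c ρ) : IsClosed (shell d φ c) :=
  (isClosed_flat d D).inter (isClosed_eq h.continuous continuous_const)

theorem shell_subset_body : shell d φ c ⊆ body d φ c := fun _ hx => ⟨hx.1, hx.2.le⟩

theorem isCompact_body (h : IsRollingSublevel d φ G c ρ) : IsCompact (body d φ c) := by
  obtain ⟨R, hR⟩ := h.bounded
  refine (isCompact_closedBall (0 : EuclideanSpace ℝ (Fin D)) R).of_isClosed_subset
    h.isClosed_body fun x hx => ?_
  simpa using hR x hx.2

theorem isCompact_shell (h : IsRollingSublevel d φ G c ρ) : IsCompact (shell d φ c) :=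
  h.isCompact_body.of_isClosed_subset h.isClosed_shell shell_subset_body

theorem zero_mem_body (h : IsRollingSublevel d φ G c ρ) : 0 ∈ body d φ c :=
  ⟨(flatSubmodule d D).zero_mem, h.zero_lt.le⟩

/-! ### The reach of the level set -/

theorem exists_shell_segment (h : IsRollingSublevel d φ G c ρ) {a b : EuclideanSpace ℝ (Fin D)}
    (ha : a ∈ flat d D) (hb : b ∈ flat d D) (hac : φ a ≤ c) (hbc : c ≤ φ b) :
    ∃ t ∈ Icc (0 : ℝ) 1, a + t • (b - a) ∈ shell d φ c := by
  have hcont : ContinuousOn (fun t : ℝ => φ (a + t • (b - a))) (Icc 0 1) :=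
    (h.continuous.comp (by fun_prop)).continuousOn
  obtain ⟨t, ht, hφ⟩ := intermediate_value_Icc zero_le_one hcont
    (show c ∈ Icc _ _ by simpa using ⟨hac, hbc⟩)
  exact ⟨t, ht, (flatSubmodule d D).add_mem ha
    ((flatSubmodule d D).smul_mem t ((flatSubmodule d D).sub_mem hb ha)), hφ⟩

/-- Inside the body, the ball around `z` that touches the level set at `x` is contained in the body,
so that `z - x` is an inner normal at `x`; since its radius is smaller than the rolling radius, it
touches the level set nowhere else. -/
theorem nearest_unique_inside (h : IsRollingSublevel d φ G c ρ) {z x y : EuclideanSpace ℝ (Fin D)}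
    {r : ℝ} (hz : z ∈ flat d D) (hzc : φ z ≤ c) (hx : x ∈ shell d φ c) (hy : y ∈ shell d φ c)
    (hzx : ‖z - x‖ = r) (hzy : ‖z - y‖ = r) (hr : ∀ s ∈ shell d φ c, r ≤ ‖z - s‖)
    (hrρ : r < ρ) : x = y := by
  have hr0 : 0 ≤ r := hzx ▸ norm_nonneg _
  have hball : ∀ w ∈ flat d D, ‖w - z‖ ≤ r → φ w ≤ c := by
    intro w hw hwr
    by_contra! hwc
    obtain ⟨t, ht, hs⟩ := h.exists_shell_segment hz hw hzc hwc.le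
    have h1 := hr _ hs
    have h2 : z - (z + t • (w - z)) = -(t • (w - z)) := by abel
    rw [h2, norm_neg, norm_smul, Real.norm_of_nonneg ht.1] at h1
    have ht1 : t ≠ 1 := by
      rintro rfl
      have := hs.2
      simp at this
      linarith
    have ht1' : t < 1 := lt_of_le_of_ne ht.2 ht1
    have hw0 : 0 < ‖w - z‖ := by
      rw [norm_pos_iff, sub_ne_zero]
      rintro rfl
      linarith
    nlinarith
  set g := G x with hg
  have hgρ : 3 * ρ ≤ ‖g‖ := h.radius_le x hx.1 hx.2
  have hρ := h.radius_pos
  have hg0 : 0 < ‖g‖ := by linarith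
  have h1 : φ (z + (r / ‖g‖) • g) ≤ c := by
    refine hball _ ((flatSubmodule d D).add_mem hz ((flatSubmodule d D).smul_mem _
      (h.gradient_mem x hx.1))) ?_
    rw [add_sub_cancel_left, norm_smul, Real.norm_of_nonneg (by positivity)]
    exact (div_mul_cancel₀ _ hg0.ne').le
  have h2 := h.tangent_le x (z + (r / ‖g‖) • g)
  have h3 : ⟪g, z - x⟫_ℝ + r * ‖g‖ ≤ 0 := by
    have : z + (r / ‖g‖) • g - x = (z - x) + (r / ‖g‖) • g := by abel
    rw [this, inner_add_right, real_inner_smul_right, real_inner_self_eq_norm_sq, hx.2] at h2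
    have h4 : r / ‖g‖ * ‖g‖ ^ 2 = r * ‖g‖ := by field_simp
    linarith
  -- equality in Cauchy–Schwarz: `z - x` is the inner normal of length `r`
  have h4 : ‖g‖ • (z - x) + r • g = 0 := by
    rw [← norm_eq_zero, ← sq_eq_zero_iff]
    refine le_antisymm ?_ (sq_nonneg _)
    rw [norm_add_sq_real, norm_smul, norm_smul, real_inner_smul_left, real_inner_smul_right,
      norm_norm, Real.norm_of_nonneg hr0, hzx, real_inner_comm]
    nlinarith [mul_nonneg hg0.le hr0]
  have h5 : ‖g‖ * ⟪z - x, y - x⟫_ℝ + r * ⟪g, y - x⟫_ℝ = 0 := by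
    rw [← real_inner_smul_left, ← real_inner_smul_left, ← inner_add_left, h4, inner_zero_left]
  have h6 : ⟪z - x, y - x⟫_ℝ = ‖y - x‖ ^ 2 / 2 := by
    have : z - y = (z - x) - (y - x) := by abel
    have h7 := norm_sub_sq_real (z - x) (y - x)
    rw [← this, hzx, hzy] at h7
    linarith
  have h7 := h.le_quadratic x y
  rw [hx.2, hy.2] at h7
  have h8 : 0 ≤ r * (⟪g, y - x⟫_ℝ + 3 / 2 * ‖y - x‖ ^ 2) := mul_nonneg hr0 (by linarith)
  have h9 : 0 ≤ (3 * r - ‖g‖) * ‖y - x‖ ^ 2 := by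
    rw [h6] at h5
    nlinarith
  have h10 : ‖y - x‖ ^ 2 ≤ 0 := by
    by_contra! hq
    nlinarith
  have h11 : ‖y - x‖ = 0 := by
    have := sq_nonneg ‖y - x‖
    exact pow_eq_zero_iff two_ne_zero |>.1 (le_antisymm h10 this)
  exact (sub_eq_zero.1 (norm_eq_zero.1 h11)).symm

/-- Outside of the body, a nearest point on the level set is a nearest point on the convex body. -/
theorem nearest_unique_outside (h : IsRollingSublevel d φ G c ρ)
    {z x y : EuclideanSpace ℝ (Fin D)}
    {r : ℝ} (hz : z ∈ flat d D) (hzc : c < φ z) (hx : x ∈ shell d φ c) (hy : y ∈ shell d φ c)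
    (hzx : ‖z - x‖ = r) (hzy : ‖z - y‖ = r) (hr : ∀ s ∈ shell d φ c, r ≤ ‖z - s‖) : x = y := by
  have hm := h.convex_body (shell_subset_body hx) (shell_subset_body hy)
    (by norm_num : (0 : ℝ) ≤ 1 / 2) (by norm_num : (0 : ℝ) ≤ 1 / 2) (by norm_num)
  have h2 := norm_sub_midpoint_sq hzx hzy
  set m := (1 / 2 : ℝ) • x + (1 / 2 : ℝ) • y
  obtain ⟨t, ht, hs⟩ := h.exists_shell_segment hm.1 hz hm.2 hzc.le
  have h1 := hr _ hs
  have h3 : z - (m + t • (z - m)) = (1 - t) • (z - m) := by module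
  rw [h3, norm_smul, Real.norm_of_nonneg (by linarith [ht.2])] at h1
  have h4 : r ≤ ‖z - m‖ := h1.trans (mul_le_of_le_one_left (norm_nonneg _) (by linarith [ht.1]))
  have hr0 : 0 ≤ r := hzx ▸ norm_nonneg _
  have h5 := pow_le_pow_left₀ hr0 h4 2
  have h6 : ‖x - y‖ = 0 := by
    have := sq_nonneg ‖x - y‖
    exact pow_eq_zero_iff two_ne_zero |>.1 (le_antisymm (by linarith) this)
  exact sub_eq_zero.1 (norm_eq_zero.1 h6)

end IsRollingSublevel

/-- Pythagoras for the orthogonal projection onto the flat. -/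
theorem exists_flat_norm_sub_sq (d : ℕ) {D : ℕ} (z : EuclideanSpace ℝ (Fin D)) :
    ∃ w ∈ flat d D, ∀ s ∈ flat d D, ‖z - s‖ ^ 2 = ‖w - s‖ ^ 2 + ‖z - w‖ ^ 2 := by
  refine ⟨(flatSubmodule d D).starProjection z,
    (flatSubmodule d D).starProjection_apply_mem z, fun s hs => ?_⟩
  set w := (flatSubmodule d D).starProjection z
  have h1 : ⟪w - s, z - w⟫_ℝ = 0 :=
    (Submodule.mem_orthogonal _ _).1 ((flatSubmodule d D).sub_starProjection_mem_orthogonal z) _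
      ((flatSubmodule d D).sub_mem ((flatSubmodule d D).starProjection_apply_mem z) hs)
  have h2 : z - s = (w - s) + (z - w) := by abel
  rw [h2, norm_add_sq_real, h1]
  ring

theorem IsRollingSublevel.le_reach_shell {d D : ℕ} {φ : EuclideanSpace ℝ (Fin D) → ℝ}
    {G : EuclideanSpace ℝ (Fin D) → EuclideanSpace ℝ (Fin D)} {c ρ : ℝ}
    (h : IsRollingSublevel d φ G c ρ) : ENNReal.ofReal ρ ≤ reach (shell d φ c) := by
  refine le_iInf₂ fun z ⟨x, hx, y, hy, hxy, hzx, hzy⟩ => ?_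
  have hne : (shell d φ c).Nonempty := ⟨x, hx⟩
  rw [ENNReal.ofReal_le_iff_le_toReal (Metric.infEDist_ne_top hne)]
  change ρ ≤ Metric.infDist z (shell d φ c)
  by_contra! hlt
  obtain ⟨w, hw, hpyth⟩ := exists_flat_norm_sub_sq d z
  rw [dist_eq_norm] at hzx hzy
  set r := Metric.infDist z (shell d φ c)
  have hxx := hpyth x hx.1
  have hyy := hpyth y hy.1
  have hwy : ‖w - y‖ = ‖w - x‖ := by
    rw [← sq_eq_sq₀ (norm_nonneg _) (norm_nonneg _)]
    rw [hzx] at hxx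
    rw [hzy] at hyy
    linarith
  have hws : ∀ s ∈ shell d φ c, ‖w - x‖ ≤ ‖w - s‖ := by
    intro s hs
    rw [← sq_le_sq₀ (norm_nonneg _) (norm_nonneg _)]
    have h1 := Metric.infDist_le_dist_of_mem (x := z) hs
    rw [dist_eq_norm] at h1
    replace h1 := pow_le_pow_left₀ (norm_nonneg _) (hzx.le.trans h1) 2
    have := hpyth s hs.1
    linarith
  have hwr : ‖w - x‖ < ρ := by
    refine lt_of_le_of_lt ?_ hlt
    rw [← hzx, ← sq_le_sq₀ (norm_nonneg _) (norm_nonneg _)]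
    nlinarith [sq_nonneg ‖z - w‖]
  rcases le_or_gt (φ w) c with hc | hc
  · exact hxy (h.nearest_unique_inside hw hc hx hy rfl hwy hws hwr)
  · exact hxy (h.nearest_unique_outside hw hc hx hy rfl hwy hws)

/-! ### Charts of the body -/

theorem hasChart_of_mem_iff {D : ℕ} {L M : Set (EuclideanSpace ℝ (Fin D))}
    {p : EuclideanSpace ℝ (Fin D)}
    (Ψ : OpenPartialHomeomorph (EuclideanSpace ℝ (Fin D)) (EuclideanSpace ℝ (Fin D)))
    (h0 : 0 ∈ Ψ.source) (hp : Ψ 0 = p) (hΨ : ContDiffOn ℝ 2 Ψ Ψ.source)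
    (hΨ' : ContDiffOn ℝ 2 Ψ.symm Ψ.target) (hM : ∀ y ∈ Ψ.target, Ψ.symm y ∈ L ↔ y ∈ M) :
    HasChart L M p := by
  refine ⟨Ψ, h0, hp, hΨ, hΨ', ?_⟩
  ext y
  constructor
  · rintro ⟨x, ⟨hx, hxL⟩, rfl⟩
    have hy := Ψ.map_source hx
    exact ⟨(hM _ hy).1 (by rwa [Ψ.left_inv hx]), hy⟩
  · rintro ⟨hyM, hy⟩
    exact ⟨Ψ.symm y, ⟨Ψ.map_target hy, (hM y hy).2 hyM⟩, Ψ.right_inv hy⟩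

/-- The coordinate vector with index `d - 1`, an inner normal of `halfFlat d D` at `0`. -/
def lastVector (d D : ℕ) : EuclideanSpace ℝ (Fin D) :=
  WithLp.toLp 2 fun i => if (i : ℕ) + 1 = d then 1 else 0

theorem lastVector_apply (d D : ℕ) (i : Fin D) :
    lastVector d D i = if (i : ℕ) + 1 = d then 1 else 0 := rfl

theorem lastVector_mem_flat (d D : ℕ) : lastVector d D ∈ flat d D := by
  intro i hi
  rw [lastVector_apply, if_neg (by omega)]

theorem inner_lastVector {d D : ℕ} (x : EuclideanSpace ℝ (Fin D)) (i : Fin D)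
    (hi : (i : ℕ) + 1 = d) : ⟪lastVector d D, x⟫_ℝ = x i := by
  rw [PiLp.inner_apply, Finset.sum_eq_single i]
  · simp [lastVector_apply, hi]
  · intro j _ hj
    rw [lastVector_apply, if_neg]
    · simp
    · intro hj'
      exact hj (Fin.ext (by omega))
  · simp

theorem norm_lastVector {d D : ℕ} (hd : 1 ≤ d) (hD : d ≤ D) : ‖lastVector d D‖ = 1 := by
  have h := inner_lastVector (d := d) (lastVector d D) ⟨d - 1, by omega⟩ (by simp; omega)
  rw [real_inner_self_eq_norm_sq, lastVector_apply, if_pos (by simp; omega)] at h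
  exact (pow_eq_one_iff_of_nonneg (norm_nonneg _) two_ne_zero).1 h

theorem mem_halfFlat_iff {d D : ℕ} (hd : 1 ≤ d) (hD : d ≤ D) {x : EuclideanSpace ℝ (Fin D)} :
    x ∈ halfFlat d D ↔ x ∈ flat d D ∧ 0 ≤ ⟪lastVector d D, x⟫_ℝ := by
  refine and_congr_right fun _ => ⟨fun h => ?_, fun h i hi => ?_⟩
  · rw [inner_lastVector x ⟨d - 1, by omega⟩ (by simp; omega)]
    exact h _ (by simp; omega)
  · rwa [inner_lastVector x i hi] at h

/-- Two vectors of the same norm in a subspace are exchanged by a linear isometry which preserves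
this subspace: a reflection. -/
theorem exists_involution_of_norm_eq {E : Type*} [NormedAddCommGroup E] [InnerProductSpace ℝ E]
    (F : Submodule ℝ E) {v w : E} (hv : v ∈ F) (hw : w ∈ F) (hvw : ‖v‖ = ‖w‖) :
    ∃ S : E ≃ₗᵢ[ℝ] E, S v = w ∧ (∀ x y, ⟪x, S y⟫_ℝ = ⟪S x, y⟫_ℝ) ∧ ∀ x, S x ∈ F ↔ x ∈ F := by
  set S := (ℝ ∙ (v - w))ᗮ.reflection with hS
  have hSS : ∀ x, S (S x) = x := (ℝ ∙ (v - w))ᗮ.reflection_reflection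
  have hmem : ∀ x ∈ F, S x ∈ F := by
    intro x hx
    rw [hS, Submodule.reflection_orthogonal_apply, Submodule.reflection_singleton_apply]
    exact F.neg_mem (F.sub_mem (nsmul_mem (F.smul_mem _ (F.sub_mem hv hw)) 2) hx)
  refine ⟨S, Submodule.reflection_sub hvw, fun x y => ?_, fun x => ⟨fun h => ?_, hmem x⟩⟩
  · rw [← S.inner_map_map, hSS]
  · rw [← hSS x]
    exact hmem _ h

namespace IsRollingSublevel

variable {d D : ℕ} {φ : EuclideanSpace ℝ (Fin D) → ℝ}
  {G : EuclideanSpace ℝ (Fin D) → EuclideanSpace ℝ (Fin D)} {c ρ : ℝ}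

theorem hasChart_flat (h : IsRollingSublevel d φ G c ρ) {p : EuclideanSpace ℝ (Fin D)}
    (hp : p ∈ flat d D) (hpc : φ p < c) : HasChart (flat d D) (body d φ c) p := by
  have hopen : IsOpen {x | φ (p + x) < c} :=
    isOpen_lt (h.continuous.comp (by fun_prop)) continuous_const
  refine hasChart_of_mem_iff
    ((Homeomorph.addLeft p).toOpenPartialHomeomorph.restrOpen {x | φ (p + x) < c} hopen)
    ?_ ?_ ?_ ?_ ?_
  · simpa using hpc
  · simp
  · exact (contDiff_const.add contDiff_id).contDiffOn
  · exact (contDiff_const.add contDiff_id).contDiffOn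
  · intro y hy
    have hy' : φ y < c := by
      have h1 : φ (p + (-p + y)) < c := hy.2
      rwa [add_neg_cancel_left] at h1
    have h2 : -p + y ∈ flat d D ↔ y ∈ flat d D :=
      (flatSubmodule d D).add_mem_iff_right ((flatSubmodule d D).neg_mem hp)
    exact h2.trans ⟨fun hy'' => ⟨hy'', hy'.le⟩, fun hy'' => hy''.1⟩

/-- At a point of the level set, a reflection that maps the inner normal to the last coordinate
vector, corrected such that the last coordinate becomes a multiple of `c - φ`, straightens the
body. -/
theorem hasChart_halfFlat (h : IsRollingSublevel d φ G c ρ) (hd : 1 ≤ d) (hD : d ≤ D)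
    {p : EuclideanSpace ℝ (Fin D)}
    (hp : p ∈ shell d φ c) : HasChart (halfFlat d D) (body d φ c) p := by
  set g := G p with hg
  have hg0 : 0 < ‖g‖ := by
    have := h.radius_le p hp.1 hp.2
    have := h.radius_pos
    linarith
  set e := lastVector d D with he
  have heF : e ∈ flat d D := lastVector_mem_flat d D
  have hen : ‖e‖ = 1 := norm_lastVector hd hD
  have hee : ⟪e, e⟫_ℝ = 1 := by rw [real_inner_self_eq_norm_sq, hen, one_pow]
  obtain ⟨S, hSg, hSadj, hSF⟩ := exists_involution_of_norm_eq (flatSubmodule d D)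
    (v := (-‖g‖) • e) (w := g) ((flatSubmodule d D).smul_mem _ heF) (h.gradient_mem p hp.1)
    (by rw [norm_smul, hen]; simp)
  have hSe : S e = -(‖g‖⁻¹ • g) := by
    have h1 : (-‖g‖) • S e = g := by rw [← map_smul, hSg]
    have h2 : ‖g‖⁻¹ * -‖g‖ = -1 := by field_simp
    calc S e = -((‖g‖⁻¹ * -‖g‖) • S e) := by rw [h2, neg_one_smul, neg_neg]
      _ = -(‖g‖⁻¹ • g) := by rw [mul_smul, h1]
  have hadj : ∀ v, ⟪e, S v⟫_ℝ = -(‖g‖⁻¹ * ⟪g, v⟫_ℝ) := fun v => by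
    rw [hSadj, hSe, inner_neg_left, real_inner_smul_left]
  set F : EuclideanSpace ℝ (Fin D) → EuclideanSpace ℝ (Fin D) :=
    fun x => S (x - p) + (‖g‖⁻¹ * (c - φ x) - ⟪e, S (x - p)⟫_ℝ) • e with hF
  have hFp : F p = 0 := by simp [hF, hp.2]
  have hFC : ContDiff ℝ 2 F := by
    have h1 : ContDiff ℝ 2 fun x => S (x - p) :=
      S.toContinuousLinearEquiv.contDiff.comp (contDiff_id.sub contDiff_const)
    exact h1.add (((contDiff_const.mul (contDiff_const.sub h.contDiff)).sub
      (contDiff_const.inner ℝ h1)).smul contDiff_const)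
  have hFd : HasFDerivAt F (S.toContinuousLinearEquiv :
      EuclideanSpace ℝ (Fin D) →L[ℝ] EuclideanSpace ℝ (Fin D)) p := by
    have h1 : HasFDerivAt (fun x => S (x - p)) (S.toContinuousLinearEquiv :
      EuclideanSpace ℝ (Fin D) →L[ℝ] EuclideanSpace ℝ (Fin D)) p :=
      (S.toContinuousLinearEquiv.hasFDerivAt).comp p ((hasFDerivAt_id p).sub_const p)
    have h2 := (h.hasGradientAt p).hasFDerivAt
    have h3 := ((h2.const_sub c).const_mul ‖g‖⁻¹).sub ((hasFDerivAt_const e p).inner ℝ h1)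
    have h4 := h1.add (h3.smul_const e)
    refine h4.congr_fderiv ?_
    ext1 v
    have := hadj v
    simp [this, ← hg]
  have hFF : ∀ x, F x ∈ flat d D ↔ x ∈ flat d D := by
    intro x
    have h1 : F x ∈ flatSubmodule d D ↔ S (x - p) ∈ flatSubmodule d D :=
      (flatSubmodule d D).add_mem_iff_left ((flatSubmodule d D).smul_mem _ heF)
    exact h1.trans ((hSF _).trans ((flatSubmodule d D).sub_mem_iff_left hp.1))
  have hFe : ∀ x, ⟪e, F x⟫_ℝ = ‖g‖⁻¹ * (c - φ x) := by
    intro x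
    simp only [hF, inner_add_right, real_inner_smul_right, hee]
    ring
  set Φ := (hFC.contDiffAt (x := p)).toOpenPartialHomeomorph F hFd two_ne_zero with hΦ
  have hΦF : ∀ x, Φ x = F x := fun x => rfl
  have hpΦ : p ∈ Φ.source :=
    (hFC.contDiffAt (x := p)).mem_toOpenPartialHomeomorph_source hFd two_ne_zero
  have h0Φ : 0 ∈ Φ.target := by
    rw [← hFp]
    exact Φ.map_source hpΦ
  have hΦ0 : Φ.symm 0 = p := by
    rw [← hFp, ← hΦF, Φ.left_inv hpΦ]
  have hsymm : ContDiffAt ℝ 2 Φ.symm 0 :=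
    Φ.contDiffAt_symm h0Φ (by rw [hΦ0]; exact hFd) hFC.contDiffAt
  obtain ⟨W, hW, hWo, h0W⟩ := eventually_nhds_iff.1 (hsymm.eventually (by simp))
  refine hasChart_of_mem_iff (Φ.symm.restrOpen W hWo) ⟨h0Φ, h0W⟩ hΦ0 ?_ ?_ ?_
  · exact fun x hx => (hW x hx.2).contDiffWithinAt
  · exact hFC.contDiffOn
  · intro y hy
    change F y ∈ halfFlat d D ↔ y ∈ body d φ c
    rw [mem_halfFlat_iff hd hD, hFF, hFe]
    refine and_congr_right fun _ => ?_
    rw [mul_nonneg_iff_of_pos_left (inv_pos.2 hg0), sub_nonneg]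

/-- An interior point of the body is not a boundary point: a half-flat chart `Ψ` would map the inner
normal of the half-flat to a vector `v` of the flat, but along the line through `p` in direction
`v`, on which the last coordinate of `Ψ⁻¹` has a local minimum, its derivative would be `1`. -/
theorem not_hasChart_halfFlat (h : IsRollingSublevel d φ G c ρ) (hd : 1 ≤ d) (hD : d ≤ D)
    {p : EuclideanSpace ℝ (Fin D)} (hp : p ∈ flat d D) (hpc : φ p < c) :
    ¬ HasChart (halfFlat d D) (body d φ c) p := by
  rintro ⟨Ψ, h0, hΨ0, hΨ, hΨ', himg⟩
  set e := lastVector d D with he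
  have hen : ‖e‖ = 1 := norm_lastVector hd hD
  have hee : ⟪e, e⟫_ℝ = 1 := by rw [real_inner_self_eq_norm_sq, hen, one_pow]
  have hpt : p ∈ Ψ.target := hΨ0 ▸ Ψ.map_source h0
  have hp0 : Ψ.symm p = 0 := by rw [← hΨ0, Ψ.left_inv h0]
  have hA := ((hΨ.contDiffAt (Ψ.open_source.mem_nhds h0)).differentiableAt
    two_ne_zero).hasFDerivAt
  have hB := ((hΨ'.contDiffAt (Ψ.open_target.mem_nhds hpt)).differentiableAt
    two_ne_zero).hasFDerivAt
  set A := fderiv ℝ Ψ 0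
  set B := fderiv ℝ Ψ.symm p
  have hBA : ∀ v, B (A v) = v := by
    have h1 : HasFDerivAt (Ψ.symm ∘ Ψ) (B.comp A) 0 := by
      refine HasFDerivAt.comp 0 ?_ hA
      rwa [hΨ0]
    have h2 : HasFDerivAt (Ψ.symm ∘ Ψ) (ContinuousLinearMap.id ℝ _) 0 :=
      (hasFDerivAt_id 0).congr_of_eventuallyEq
        (Filter.eventually_of_mem (Ψ.open_source.mem_nhds h0) fun x hx => Ψ.left_inv hx)
    intro v
    exact congrArg (fun T => T v) (h1.unique h2)
  set v := A e with hv
  have hline : ∀ (q w : EuclideanSpace ℝ (Fin D)),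
      HasDerivAt (fun t : ℝ => q + t • w) w 0 := by
    intro q w
    simpa using ((hasDerivAt_id (0 : ℝ)).smul_const w).const_add q
  have hvF : v ∈ flat d D := by
    intro i hi
    have h1 : HasDerivAt (fun t : ℝ => Ψ (0 + t • e)) v 0 := by
      refine HasFDerivAt.comp_hasDerivAt (0 : ℝ) ?_ (hline 0 e)
      simpa using hA
    have h2 : HasDerivAt (fun t : ℝ => Ψ (0 + t • e) i) (v i) 0 :=
      ((EuclideanSpace.proj i : EuclideanSpace ℝ (Fin D) →L[ℝ] ℝ).hasFDerivAt).comp_hasDerivAt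
        (0 : ℝ) h1
    have h3 : ∀ᶠ t in 𝓝 (0 : ℝ), (0 : EuclideanSpace ℝ (Fin D)) + t • e ∈ Ψ.source :=
      (hline 0 e).continuousAt.eventually_mem (Ψ.open_source.mem_nhds (by simpa using h0))
    have h4 : ∀ᶠ t in 𝓝[Ici 0] (0 : ℝ), Ψ (0 + t • e) i = 0 := by
      filter_upwards [nhdsWithin_le_nhds h3, self_mem_nhdsWithin] with t ht ht0
      have h5 : (0 : EuclideanSpace ℝ (Fin D)) + t • e ∈ halfFlat d D := by
        rw [zero_add, mem_halfFlat_iff hd hD, ← he, real_inner_smul_right, hee, mul_one]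
        exact ⟨(flatSubmodule d D).smul_mem t (lastVector_mem_flat d D), ht0⟩
      have h6 : Ψ (0 + t • e) ∈ body d φ c ∩ Ψ.target := by
        rw [← himg]
        exact ⟨_, ⟨ht, h5⟩, rfl⟩
      exact h6.1.1 i hi
    have h5 : HasDerivWithinAt (fun t : ℝ => Ψ (0 + t • e) i) 0 (Ici 0) 0 :=
      (hasDerivWithinAt_const (0 : ℝ) (Ici 0) (0 : ℝ)).congr_of_eventuallyEq h4
        (h4.self_of_nhdsWithin (by simp))
    exact (uniqueDiffOn_Ici (0 : ℝ) 0 (by simp)).eq_deriv _ h2.hasDerivWithinAt h5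
  have h1 : HasDerivAt (fun t : ℝ => ⟪e, Ψ.symm (p + t • v)⟫_ℝ) 1 0 := by
    have h2 : HasDerivAt (fun t : ℝ => Ψ.symm (p + t • v)) (B v) 0 := by
      refine HasFDerivAt.comp_hasDerivAt (0 : ℝ) ?_ (hline p v)
      simpa using hB
    have h3 := (hasDerivAt_const (0 : ℝ) e).inner ℝ h2
    simpa [hv, hBA, hen] using h3
  have hmin : IsLocalMin (fun t : ℝ => ⟪e, Ψ.symm (p + t • v)⟫_ℝ) 0 := by
    have h2 : ∀ᶠ t in 𝓝 (0 : ℝ), p + t • v ∈ Ψ.target :=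
      (hline p v).continuousAt.eventually_mem (Ψ.open_target.mem_nhds (by simpa using hpt))
    have h3 : ∀ᶠ t in 𝓝 (0 : ℝ), p + t • v ∈ {x | φ x < c} :=
      (hline p v).continuousAt.eventually_mem
        ((isOpen_lt h.continuous continuous_const).mem_nhds (by simpa using hpc))
    filter_upwards [h2, h3] with t ht ht'
    have h4 : p + t • v ∈ Ψ '' (Ψ.source ∩ halfFlat d D) := by
      rw [himg]
      exact ⟨⟨(flatSubmodule d D).add_mem hp ((flatSubmodule d D).smul_mem t hvF), ht'.le⟩, ht⟩
    obtain ⟨x, ⟨hx, hxL⟩, hxe⟩ := h4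
    rw [← hxe, Ψ.left_inv hx]
    simpa [hp0] using ((mem_halfFlat_iff hd hD).1 hxL).2
  exact one_ne_zero (hmin.hasDerivAt_eq_zero h1)

theorem boundary_body (h : IsRollingSublevel d φ G c ρ) (hd : 1 ≤ d) (hD : d ≤ D) :
    boundary d (body d φ c) = shell d φ c := by
  ext p
  refine ⟨fun hp => ⟨hp.1.1, ?_⟩, fun hp => ⟨shell_subset_body hp, h.hasChart_halfFlat hd hD hp⟩⟩
  exact (hp.1.2.lt_or_eq).resolve_left fun hlt => h.not_hasChart_halfFlat hd hD hp.1.1 hlt hp.2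

theorem body_mem_geometricModel (h : IsRollingSublevel d φ G c ρ) (hd : 1 ≤ d) (hD : d ≤ D)
    (τmin : ℝ≥0∞) : body d φ c ∈ geometricModel d D τmin (ENNReal.ofReal ρ) := by
  refine ⟨h.isCompact_body, h.convex_body.isConnected ⟨0, h.zero_mem_body⟩,
    ⟨h.isClosed_body, fun p hp => ?_⟩, ?_, ?_⟩
  · rw [h.boundary_body hd hD]
    rcases hp.2.lt_or_eq with hlt | heq
    · exact Or.inl ⟨hp, h.hasChart_flat hp.1 hlt⟩
    · exact Or.inr ⟨hp.1, heq⟩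
  · rw [reach_eq_top_of_convex h.convex_body]
    exact le_top
  · rw [h.boundary_body hd hD]
    exact h.le_reach_shell

end IsRollingSublevel

/-! ### The bump -/

theorem hasDerivAt_max_zero_pow (n : ℕ) (y : ℝ) :
    HasDerivAt (fun z : ℝ => max 0 z ^ (n + 2)) ((n + 2) * max 0 y ^ (n + 1)) y := by
  rcases lt_trichotomy y 0 with hy | rfl | hy
  · rw [max_eq_left hy.le, zero_pow n.succ_ne_zero, mul_zero]
    refine (hasDerivAt_const y (0 : ℝ)).congr_of_eventuallyEq ?_
    filter_upwards [Iio_mem_nhds hy] with z hz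
    rw [max_eq_left (le_of_lt hz), zero_pow (by omega)]
  · have h1 : (fun z : ℝ => max 0 z ^ (n + 2)) =O[𝓝 0] fun z => ‖z - 0‖ ^ (n + 2) := by
      refine Asymptotics.IsBigO.of_bound 1 (Filter.Eventually.of_forall fun z => ?_)
      rw [norm_pow, norm_pow, norm_norm, one_mul, sub_zero]
      refine pow_le_pow_left₀ (norm_nonneg _) ?_ _
      rw [Real.norm_of_nonneg (le_max_left _ _)]
      exact max_le (norm_nonneg _) (le_abs_self z)
    have h2 := (h1.hasFDerivAt (𝕜 := ℝ) (by omega)).hasDerivAt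
    simpa using h2
  · rw [max_eq_right hy.le]
    have h1 := hasDerivAt_pow (n + 2) y
    push_cast at h1
    refine h1.congr_of_eventuallyEq ?_
    filter_upwards [Ioi_mem_nhds hy] with z hz
    rw [max_eq_right (le_of_lt hz)]

theorem contDiff_max_zero_pow_three : ContDiff ℝ 2 fun z : ℝ => max 0 z ^ 3 := by
  have h2 : ContDiff ℝ 1 fun z : ℝ => max 0 z ^ 2 := by
    rw [contDiff_one_iff_deriv]
    refine ⟨fun y => (hasDerivAt_max_zero_pow 0 y).differentiableAt, ?_⟩
    have : deriv (fun z : ℝ => max 0 z ^ 2) = fun y : ℝ => 2 * max 0 y := funext fun y => by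
      simpa using (hasDerivAt_max_zero_pow 0 y).deriv
    rw [this]
    fun_prop
  have h3 : (2 : WithTop ℕ∞) = 1 + 1 := by norm_num
  rw [h3, contDiff_succ_iff_deriv]
  refine ⟨fun y => (hasDerivAt_max_zero_pow 1 y).differentiableAt, by simp, ?_⟩
  have : deriv (fun z : ℝ => max 0 z ^ 3) = fun y : ℝ => 3 * max 0 y ^ 2 := funext fun y => by
    rw [(hasDerivAt_max_zero_pow 1 y).deriv]
    norm_num
  rw [this]
  exact contDiff_const.mul h2

/-- The `C²` bump `(1 - ‖x‖²)₊³`, which vanishes outside of the unit ball. -/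
noncomputable def bump {E : Type*} [NormedAddCommGroup E] (x : E) : ℝ := max 0 (1 - ‖x‖ ^ 2) ^ 3

/-- The gradient of `bump`. -/
noncomputable def bumpGradient {E : Type*} [NormedAddCommGroup E] [NormedSpace ℝ E] (x : E) : E :=
  (-6 * max 0 (1 - ‖x‖ ^ 2) ^ 2) • x

section Bump

variable {E : Type*} [NormedAddCommGroup E]

theorem bump_nonneg (x : E) : 0 ≤ bump x := pow_nonneg (le_max_left _ _) 3

theorem bump_le_one (x : E) : bump x ≤ 1 :=
  pow_le_one₀ (le_max_left _ _) (max_le zero_le_one (by linarith [sq_nonneg ‖x‖]))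

theorem bump_eq_zero {x : E} (hx : 1 ≤ ‖x‖) : bump x = 0 := by
  have : 1 ≤ ‖x‖ ^ 2 := one_le_pow₀ hx
  rw [bump, max_eq_left (by linarith), zero_pow three_ne_zero]

theorem le_bump {x : E} (hx : ‖x‖ ≤ 1 / 2) : 1 / 4 ≤ bump x := by
  have h1 : ‖x‖ ^ 2 ≤ (1 / 2) ^ 2 := pow_le_pow_left₀ (norm_nonneg x) hx 2
  have h2 : (3 / 4 : ℝ) ≤ max 0 (1 - ‖x‖ ^ 2) := le_max_of_le_right (by linarith)
  have h3 := pow_le_pow_left₀ (by norm_num) h2 3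
  rw [bump]
  linarith

variable [InnerProductSpace ℝ E]

theorem contDiff_bump : ContDiff ℝ 2 (bump : E → ℝ) :=
  contDiff_max_zero_pow_three.comp (contDiff_const.sub (contDiff_norm_sq ℝ))

theorem hasFDerivAt_bump (x : E) : HasFDerivAt bump (innerSL ℝ (bumpGradient x)) x := by
  have h1 : HasFDerivAt (fun y : E => 1 - ‖y‖ ^ 2) (-(2 • innerSL ℝ x)) x := by
    simpa using ((hasStrictFDerivAt_norm_sq x).hasFDerivAt).const_sub 1
  have h2 := (hasDerivAt_max_zero_pow 1 (1 - ‖x‖ ^ 2)).comp_hasFDerivAt x h1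
  refine h2.congr_fderiv ?_
  ext v
  simp only [bumpGradient, innerSL_apply_apply, real_inner_smul_left,
    smul_apply, neg_apply, smul_eq_mul, nsmul_eq_mul]
  push_cast
  ring

theorem norm_bumpGradient_le (x : E) : ‖bumpGradient x‖ ≤ 6 := by
  rw [bumpGradient, norm_smul, norm_mul, norm_neg, Real.norm_of_nonneg (by norm_num : (0:ℝ) ≤ 6),
    norm_pow, Real.norm_of_nonneg (le_max_left _ _), mul_assoc]
  have h0 : 0 ≤ max 0 (1 - ‖x‖ ^ 2) := le_max_left _ _
  have h1 : max 0 (1 - ‖x‖ ^ 2) ^ 2 ≤ 1 :=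
    pow_le_one₀ h0 (max_le zero_le_one (by linarith [sq_nonneg ‖x‖]))
  suffices h : max 0 (1 - ‖x‖ ^ 2) ^ 2 * ‖x‖ ≤ 1 by linarith
  rcases le_total ‖x‖ 1 with hx | hx
  · exact mul_le_one₀ h1 (norm_nonneg x) hx
  · have : 1 ≤ ‖x‖ ^ 2 := one_le_pow₀ hx
    rw [max_eq_left (by linarith)]
    norm_num

theorem inner_bumpGradient (x y : E) :
    ⟪bumpGradient x, y - x⟫_ℝ = 3 * max 0 (1 - ‖x‖ ^ 2) ^ 2 *
      ((1 - ‖y‖ ^ 2) - (1 - ‖x‖ ^ 2) + ‖y - x‖ ^ 2) := by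
  have h1 := norm_add_sq_real x (y - x)
  rw [add_sub_cancel] at h1
  rw [bumpGradient, real_inner_smul_left]
  linear_combination 3 * max 0 (1 - ‖x‖ ^ 2) ^ 2 * h1

/-- The second derivative of `bump` is at least `-6`: with `u = 1 - ‖x‖²` and `w = 1 - ‖y‖²`, the
convex function `u₊³` lies above its tangents, and `w - u` is linear in `y - x` up to `-‖y - x‖²`. -/
theorem le_bump_add (x y : E) :
    bump x + ⟪bumpGradient x, y - x⟫_ℝ - 3 * ‖y - x‖ ^ 2 ≤ bump y := by
  rw [inner_bumpGradient, bump, bump]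
  have hu : 1 - ‖x‖ ^ 2 ≤ 1 := by linarith [sq_nonneg ‖x‖]
  generalize 1 - ‖x‖ ^ 2 = u at *
  generalize 1 - ‖y‖ ^ 2 = w at *
  have hv : 0 ≤ ‖y - x‖ ^ 2 := sq_nonneg _
  generalize ‖y - x‖ ^ 2 = q at *
  have hk : 0 ≤ max 0 w := le_max_left _ _
  have hkw : w ≤ max 0 w := le_max_right _ _
  generalize max 0 w = k at *
  rcases le_total u 0 with hu0 | hu0
  · rw [max_eq_left hu0]
    have := pow_nonneg hk 3
    norm_num
    linarith
  · rw [max_eq_right hu0]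
    have h1 : u ^ 2 * q ≤ q := mul_le_of_le_one_left hv (pow_le_one₀ hu0 hu)
    have h2 : 0 ≤ (k - u) ^ 2 * (k + 2 * u) := by positivity
    have h3 : 0 ≤ u ^ 2 * (k - w) := mul_nonneg (sq_nonneg u) (sub_nonneg.2 hkw)
    nlinarith

/-- The second derivative of `bump` is at most `24`, as an upper bound around the tangents. -/
theorem bump_le_add (x y : E) :
    bump y ≤ bump x + ⟪bumpGradient x, y - x⟫_ℝ + 12 * ‖y - x‖ ^ 2 := by
  have htri : ‖x‖ ≤ ‖y‖ + ‖y - x‖ := by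
    have := norm_sub_norm_le x y
    rw [norm_sub_rev] at this
    linarith
  have htri' : ‖y‖ ≤ ‖x‖ + ‖y - x‖ := by
    have := norm_sub_norm_le y x
    linarith
  have hinn : ⟪x, y - x⟫_ℝ ≤ ‖x‖ * ‖y - x‖ := real_inner_le_norm _ _
  have hx := norm_nonneg x
  have hy := norm_nonneg y
  have hv := norm_nonneg (y - x)
  rcases le_or_gt (1 - ‖x‖ ^ 2) 0 with hu | hu
  · have h0 : bump x = 0 := by rw [bump, max_eq_left hu, zero_pow three_ne_zero]
    rw [inner_bumpGradient, h0, max_eq_left hu, bump]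
    rcases le_or_gt (1 - ‖y‖ ^ 2) 0 with hw | hw
    · rw [max_eq_left hw]
      norm_num
    · rw [max_eq_right hw.le]
      have hx1 : 1 ≤ ‖x‖ := by nlinarith
      have hy1 : ‖y‖ ≤ 1 := by nlinarith
      have h1 : 1 - ‖y‖ ^ 2 ≤ 2 * ‖y - x‖ := by nlinarith
      have h2 : (1 - ‖y‖ ^ 2) ^ 3 ≤ (1 - ‖y‖ ^ 2) ^ 2 :=
        pow_le_pow_of_le_one hw.le (by linarith [sq_nonneg ‖y‖]) (by norm_num)
      have h3 := pow_le_pow_left₀ hw.le h1 2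
      nlinarith
  · have hx1 : ‖x‖ ≤ 1 := by nlinarith
    have hu1 : 1 - ‖x‖ ^ 2 ≤ 1 := by linarith [sq_nonneg ‖x‖]
    rcases le_or_gt (1 - ‖y‖ ^ 2) 0 with hw | hw
    · rw [bump, bump, max_eq_left hw, bumpGradient, real_inner_smul_left, max_eq_right hu.le]
      have h1 : ⟪x, y - x⟫_ℝ ≤ ‖y - x‖ :=
        hinn.trans (mul_le_of_le_one_left hv hx1)
      generalize 1 - ‖x‖ ^ 2 = u at *
      -- `0 ≤ u³ - 6 u² v + 12 v²` for `v = ‖y - x‖` and `u ≤ 1`, by completing the square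
      have h2 := mul_le_mul_of_nonneg_left h1 (sq_nonneg u)
      have h3 : 0 ≤ u ^ 3 * (1 - 3 / 4 * u) := mul_nonneg (pow_nonneg hu.le 3) (by linarith)
      nlinarith [sq_nonneg (‖y - x‖ - u ^ 2 / 4)]
    · have hy1 : ‖y‖ ≤ 1 := by nlinarith
      rw [inner_bumpGradient, bump, bump, max_eq_right hu.le, max_eq_right hw.le]
      have h1 : ((1 - ‖y‖ ^ 2) - (1 - ‖x‖ ^ 2)) ^ 2 ≤ (2 * ‖y - x‖) ^ 2 := by
        apply sq_le_sq'
        · nlinarith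
        · nlinarith
      have hw1 : 1 - ‖y‖ ^ 2 ≤ 1 := by linarith [sq_nonneg ‖y‖]
      generalize 1 - ‖x‖ ^ 2 = u at *
      generalize 1 - ‖y‖ ^ 2 = w at *
      have h2 : (w - u) ^ 2 * (w + 2 * u) ≤ (w - u) ^ 2 * 3 :=
        mul_le_mul_of_nonneg_left (by linarith) (sq_nonneg _)
      have h3 : 0 ≤ u ^ 2 * ‖y - x‖ ^ 2 := by positivity
      nlinarith

end Bump

/-- The squared norm, perturbed by a bump of width `s` and height `η s²` at `a`. The scaling is such
that the size of the second derivative of the perturbation does not depend on `s`. -/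
noncomputable def bumpedSq {D : ℕ} (η s : ℝ) (a x : EuclideanSpace ℝ (Fin D)) : ℝ :=
  ‖x‖ ^ 2 + η * s ^ 2 * bump (s⁻¹ • (x - a))

/-- The gradient of `bumpedSq`. -/
noncomputable def bumpedSqGradient {D : ℕ} (η s : ℝ) (a x : EuclideanSpace ℝ (Fin D)) :
    EuclideanSpace ℝ (Fin D) :=
  (2 : ℝ) • x + (η * s) • bumpGradient (s⁻¹ • (x - a))

section BumpedSq

variable {D : ℕ} {η s R : ℝ} {a : EuclideanSpace ℝ (Fin D)}

theorem sq_le_bumpedSq (hη : 0 ≤ η) (x : EuclideanSpace ℝ (Fin D)) :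
    ‖x‖ ^ 2 ≤ bumpedSq η s a x :=
  le_add_of_nonneg_right (mul_nonneg (mul_nonneg hη (sq_nonneg s)) (bump_nonneg _))

theorem bumpedSq_le (hη : 0 ≤ η) (x : EuclideanSpace ℝ (Fin D)) :
    bumpedSq η s a x ≤ ‖x‖ ^ 2 + η * s ^ 2 :=
  add_le_add_right (mul_le_of_le_one_right (mul_nonneg hη (sq_nonneg s)) (bump_le_one _)) _

theorem bumpedSq_of_le_norm (hs : 0 < s) {x : EuclideanSpace ℝ (Fin D)} (hx : s ≤ ‖x - a‖) :
    bumpedSq η s a x = ‖x‖ ^ 2 := by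
  rw [bumpedSq, bump_eq_zero, mul_zero, add_zero]
  rw [norm_smul, norm_inv, Real.norm_of_nonneg hs.le, ← div_eq_inv_mul, one_le_div hs]
  exact hx

theorem bumpedSq_zero_left (x : EuclideanSpace ℝ (Fin D)) : bumpedSq 0 s a x = ‖x‖ ^ 2 := by
  simp [bumpedSq]

theorem bumpedSq_expand (hs : 0 < s) (x y : EuclideanSpace ℝ (Fin D)) :
    bumpedSq η s a y - bumpedSq η s a x - ⟪bumpedSqGradient η s a x, y - x⟫_ℝ =
      ‖y - x‖ ^ 2 + η * s ^ 2 * (bump (s⁻¹ • (y - a)) - bump (s⁻¹ • (x - a)) -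
        ⟪bumpGradient (s⁻¹ • (x - a)), s⁻¹ • (y - a) - s⁻¹ • (x - a)⟫_ℝ) := by
  have h1 := norm_add_sq_real x (y - x)
  rw [add_sub_cancel] at h1
  have h2 : s⁻¹ • (y - a) - s⁻¹ • (x - a) = s⁻¹ • (y - x) := by module
  rw [h2, bumpedSq, bumpedSq, bumpedSqGradient, inner_add_left, real_inner_smul_left,
    real_inner_smul_left, real_inner_smul_right, h1]
  field_simp
  ring

theorem norm_sub_scaled_sq (hs : 0 < s) (x y : EuclideanSpace ℝ (Fin D)) :
    s ^ 2 * ‖s⁻¹ • (y - a) - s⁻¹ • (x - a)‖ ^ 2 = ‖y - x‖ ^ 2 := by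
  have h2 : s⁻¹ • (y - a) - s⁻¹ • (x - a) = s⁻¹ • (y - x) := by module
  rw [h2, norm_smul, norm_inv, Real.norm_of_nonneg hs.le, mul_pow, inv_pow,
    mul_inv_cancel_left₀ (pow_ne_zero 2 hs.ne')]

/-- For `η ≤ 1 / 24`, the bump changes the second derivative of `‖x‖²`, which is `2`, by an amount
between `-1` and `1`, and its gradient `2 x` by at most `R / 4`. -/
theorem isRollingSublevel_bumpedSq {d : ℕ} (hη : 0 ≤ η) (hη' : η ≤ 1 / 24) (hs : 0 < s)
    (hsR : s ≤ R) (ha : a ∈ flat d D) :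
    IsRollingSublevel d (bumpedSq η s a) (bumpedSqGradient η s a) (R ^ 2) (R / 2) := by
  have hR : 0 < R := hs.trans_le hsR
  have hsR2 : s ^ 2 ≤ R ^ 2 := pow_le_pow_left₀ hs.le hsR 2
  have hs2 : 0 < s ^ 2 := pow_pos hs 2
  have hηs : η * s ^ 2 ≤ 1 / 24 * R ^ 2 := mul_le_mul hη' hsR2 hs2.le (by norm_num)
  refine ⟨?_, fun x => ?_, fun x hx => ?_, fun x y => ?_, fun x y => ?_, by positivity,
    fun x hx hxR => ?_, ?_, R, fun x hx => ?_⟩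
  · exact (contDiff_norm_sq ℝ).add
      (contDiff_const.mul (contDiff_bump.comp ((contDiff_id.sub contDiff_const).const_smul _)))
  · rw [hasGradientAt_iff_hasFDerivAt]
    have h1 : HasFDerivAt (fun y : EuclideanSpace ℝ (Fin D) => s⁻¹ • (y - a))
        (s⁻¹ • ContinuousLinearMap.id ℝ _) x :=
      ((hasFDerivAt_id x).sub_const a).const_smul s⁻¹
    have h2 := ((hasFDerivAt_bump (s⁻¹ • (x - a))).comp x h1).const_mul (η * s ^ 2)
    refine ((hasStrictFDerivAt_norm_sq x).hasFDerivAt.add h2).congr_fderiv ?_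
    ext v
    simp only [bumpedSqGradient, add_apply, smul_apply,
      innerSL_apply_apply, ContinuousLinearMap.comp_apply, ContinuousLinearMap.id_apply,
      InnerProductSpace.toDual_apply_apply, inner_add_left, real_inner_smul_left,
      real_inner_smul_right, smul_eq_mul, nsmul_eq_mul]
    push_cast
    field_simp
  · refine (flatSubmodule d D).add_mem ((flatSubmodule d D).smul_mem _ hx)
      ((flatSubmodule d D).smul_mem _ ((flatSubmodule d D).smul_mem _
        ((flatSubmodule d D).smul_mem _ ((flatSubmodule d D).sub_mem hx ha))))
  · have h1 := bumpedSq_expand (η := η) (a := a) hs x y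
    have h2 := le_bump_add (s⁻¹ • (x - a)) (s⁻¹ • (y - a))
    have h3 := norm_sub_scaled_sq (a := a) hs x y
    have h4 := mul_nonneg (mul_nonneg hη hs2.le) (sub_nonneg.2 h2)
    have h5 : η * ‖y - x‖ ^ 2 ≤ 1 / 24 * ‖y - x‖ ^ 2 :=
      mul_le_mul_of_nonneg_right hη' (sq_nonneg _)
    have h6 := sq_nonneg ‖y - x‖
    rw [← h3] at h5 h6 h1
    nlinarith
  · have h1 := bumpedSq_expand (η := η) (a := a) hs x y
    have h2 := bump_le_add (s⁻¹ • (x - a)) (s⁻¹ • (y - a))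
    have h3 := norm_sub_scaled_sq (a := a) hs x y
    have h4 := mul_nonneg (mul_nonneg hη hs2.le) (sub_nonneg.2 h2)
    have h5 : η * ‖y - x‖ ^ 2 ≤ 1 / 24 * ‖y - x‖ ^ 2 :=
      mul_le_mul_of_nonneg_right hη' (sq_nonneg _)
    rw [← h3] at h5 h1 ⊢
    nlinarith
  · have h1 : R ^ 2 ≤ ‖x‖ ^ 2 + η * s ^ 2 := hxR ▸ bumpedSq_le hη x
    have h2 : 9 / 10 * R ≤ ‖x‖ := by
      rw [← sq_le_sq₀ (by positivity) (norm_nonneg x)]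
      nlinarith
    have h3 : ‖(η * s) • bumpGradient (s⁻¹ • (x - a))‖ ≤ 1 / 24 * R * 6 := by
      rw [norm_smul, Real.norm_of_nonneg (by positivity)]
      exact mul_le_mul (mul_le_mul hη' hsR hs.le (by norm_num)) (norm_bumpGradient_le _)
        (norm_nonneg _) (by positivity)
    have h4 := norm_sub_le_norm_add ((2 : ℝ) • x) ((η * s) • bumpGradient (s⁻¹ • (x - a)))
    rw [norm_smul, Real.norm_of_nonneg zero_le_two] at h4
    rw [bumpedSqGradient]
    linarith
  · have h1 := bumpedSq_le (s := s) (a := a) hη 0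
    rw [norm_zero] at h1
    have := pow_pos hR 2
    linarith
  · have h1 := (sq_le_bumpedSq hη x).trans hx
    rwa [sq_le_sq₀ (norm_nonneg _) hR.le] at h1

end BumpedSq

/-! ### The Hausdorff measure on the flat -/

/-- The isometric embedding of `ℝ^d` onto the flat of `ℝ^D`. -/
noncomputable def flatEmbedding {d D : ℕ} (hD : d ≤ D) :
    EuclideanSpace ℝ (Fin d) →ₗᵢ[ℝ] EuclideanSpace ℝ (Fin D) where
  toFun x := WithLp.toLp 2 fun i => if h : (i : ℕ) < d then x ⟨i, h⟩ else 0
  map_add' x y := by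
    ext i
    by_cases h : (i : ℕ) < d <;> simp [h]
  map_smul' a x := by
    ext i
    by_cases h : (i : ℕ) < d <;> simp [h]
  norm_map' x := by
    change ‖WithLp.toLp 2 fun i : Fin D => if h : (i : ℕ) < d then x ⟨i, h⟩ else 0‖ = ‖x‖
    rw [EuclideanSpace.norm_eq, EuclideanSpace.norm_eq]
    congr 1
    symm
    refine Fintype.sum_of_injective (Fin.castLE hD) (Fin.castLE_injective hD) _ _
      (fun i hi => ?_) fun i => by simp
    have h : ¬ (i : ℕ) < d := fun h => hi ⟨⟨i, h⟩, rfl⟩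
    simp [h]

theorem flatEmbedding_apply {d D : ℕ} (hD : d ≤ D) (x : EuclideanSpace ℝ (Fin d)) (i : Fin D) :
    flatEmbedding hD x i = if h : (i : ℕ) < d then x ⟨i, h⟩ else 0 := rfl

theorem range_flatEmbedding {d D : ℕ} (hD : d ≤ D) : range (flatEmbedding hD) = flat d D := by
  ext x
  constructor
  · rintro ⟨y, rfl⟩ i hi
    rw [flatEmbedding_apply, dif_neg (by omega)]
  · intro hx
    refine ⟨WithLp.toLp 2 fun i => x (Fin.castLE hD i), ?_⟩
    ext i
    rw [flatEmbedding_apply]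
    split_ifs with h
    · rfl
    · exact (hx i (by omega)).symm

instance isAddHaarMeasure_hausdorffVolume (d : ℕ) : (hausdorffVolume d d).IsAddHaarMeasure := by
  have h : (Measure.hausdorffMeasure (d : ℝ) :
      Measure (EuclideanSpace ℝ (Fin d))).IsAddHaarMeasure := by
    simpa using isAddHaarMeasure_hausdorffMeasure (E := EuclideanSpace ℝ (Fin d))
  refine Measure.IsAddHaarMeasure.smul _ ?_ ?_
  · exact (ENNReal.div_pos (Metric.measure_ball_pos _ _ one_pos).ne' (by simp)).ne'
  · exact ENNReal.div_ne_top measure_ball_lt_top.ne (by simp)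

theorem hausdorffVolume_image {d D : ℕ} (hD : d ≤ D) (A : Set (EuclideanSpace ℝ (Fin d))) :
    hausdorffVolume d D (flatEmbedding hD '' A) = hausdorffVolume d d A := by
  rw [hausdorffVolume, hausdorffVolume, Measure.smul_apply, Measure.smul_apply,
    (flatEmbedding hD).isometry.hausdorffMeasure_image (Or.inl (Nat.cast_nonneg d))]

theorem hausdorffVolume_inter_flat {d D : ℕ} (hD : d ≤ D) (A : Set (EuclideanSpace ℝ (Fin D))) :
    hausdorffVolume d D (A ∩ flat d D) = hausdorffVolume d d (flatEmbedding hD ⁻¹' A) := by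
  rw [← hausdorffVolume_image hD, image_preimage_eq_inter_range, range_flatEmbedding]

theorem hausdorffVolume_inter_flat_pos {d D : ℕ} (hD : d ≤ D)
    {U : Set (EuclideanSpace ℝ (Fin D))} (hU : IsOpen U) (hne : (U ∩ flat d D).Nonempty) :
    0 < hausdorffVolume d D (U ∩ flat d D) := by
  rw [hausdorffVolume_inter_flat hD]
  refine (hU.preimage (flatEmbedding hD).continuous).measure_pos _ ?_
  obtain ⟨x, hxU, hx⟩ := hne
  rw [← range_flatEmbedding hD] at hx
  obtain ⟨y, rfl⟩ := hx
  exact ⟨y, hxU⟩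

/-- The volume of the unit ball of `ℝ^d`, with respect to `hausdorffVolume d d`. -/
noncomputable def unitBallVolume (d : ℕ) : ℝ :=
  (hausdorffVolume d d (Metric.ball 0 1)).toReal

theorem unitBallVolume_pos (d : ℕ) : 0 < unitBallVolume d :=
  ENNReal.toReal_pos (Metric.measure_ball_pos _ _ one_pos).ne' measure_ball_lt_top.ne

theorem hausdorffVolume_closedBall {d D : ℕ} (hD : d ≤ D) {x : EuclideanSpace ℝ (Fin D)}
    (hx : x ∈ flat d D) {r : ℝ} (hr : 0 ≤ r) :
    hausdorffVolume d D (Metric.closedBall x r ∩ flat d D) =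
      ENNReal.ofReal (unitBallVolume d * r ^ d) := by
  rw [← range_flatEmbedding hD] at hx
  obtain ⟨y, rfl⟩ := hx
  rw [hausdorffVolume_inter_flat hD, (flatEmbedding hD).isometry.preimage_closedBall,
    Measure.addHaar_closedBall _ _ hr, finrank_euclideanSpace_fin, mul_comm,
    ENNReal.ofReal_mul (unitBallVolume_pos d).le, unitBallVolume,
    ENNReal.ofReal_toReal measure_ball_lt_top.ne]

/-- A box of height `t² R` along the first axis and of width `2 t R` along the other axes has
volume of order `R^d t^(d+1)`. -/
theorem exists_hausdorffVolume_box_le {d : ℕ} (hd : 1 ≤ d) : ∃ K : ℝ, 0 < K ∧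
    ∀ R t : ℝ, 0 < R → 0 < t → hausdorffVolume d d {x | ∀ i : Fin d,
      if (i : ℕ) = 0 then x i ∈ Icc (R - t ^ 2 * R) R else x i ∈ Icc (-(t * R)) (t * R)} ≤
        ENNReal.ofReal (K * (R ^ d * t ^ (d + 1))) := by
  obtain ⟨m, rfl⟩ : ∃ m, d = m + 1 := ⟨d - 1, by omega⟩
  set μ := hausdorffVolume (m + 1) (m + 1)
  set k : ℝ := ((μ.addHaarScalarFactor volume : NNReal) : ℝ) with hk
  have hμ : μ = ENNReal.ofReal k • volume := by
    rw [hk, ENNReal.ofReal_coe_nnreal]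
    exact Measure.isAddLeftInvariant_eq_smul μ volume
  have hk0 : 0 ≤ k := NNReal.coe_nonneg _
  refine ⟨(k + 1) * 2 ^ m, by positivity, fun R t hR ht => ?_⟩
  set I : Fin (m + 1) → Set ℝ :=
    Fin.cons (Icc (R - t ^ 2 * R) R) fun _ => Icc (-(t * R)) (t * R) with hI
  have hset : {x : EuclideanSpace ℝ (Fin (m + 1)) | ∀ i : Fin (m + 1),
      if (i : ℕ) = 0 then x i ∈ Icc (R - t ^ 2 * R) R else x i ∈ Icc (-(t * R)) (t * R)} =
      (WithLp.ofLp : EuclideanSpace ℝ (Fin (m + 1)) → _) ⁻¹' univ.pi I := by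
    ext x
    simp only [mem_ofPred_eq, mem_preimage, mem_univ_pi]
    refine forall_congr' fun i => ?_
    refine Fin.cases ?_ (fun j => ?_) i
    · simp [hI]
    · simp [hI]
  have hvol : (volume : Measure (EuclideanSpace ℝ (Fin (m + 1))))
      (WithLp.ofLp ⁻¹' univ.pi I) = ENNReal.ofReal (2 ^ m * (R ^ (m + 1) * t ^ (m + 2))) := by
    have hmeas : MeasurableSet (univ.pi I) := by
      refine MeasurableSet.univ_pi fun i => ?_
      refine Fin.cases ?_ (fun j => ?_) i
      · exact measurableSet_Icc
      · exact measurableSet_Icc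
    rw [(PiLp.volume_preserving_ofLp (Fin (m + 1))).measure_preimage hmeas.nullMeasurableSet,
      volume_pi_pi, Fin.prod_univ_succ]
    simp only [hI, Fin.cons_zero, Fin.cons_succ, Real.volume_Icc, Finset.prod_const,
      Finset.card_univ, Fintype.card_fin]
    rw [← ENNReal.ofReal_pow (by nlinarith [mul_pos ht hR]),
      ← ENNReal.ofReal_mul (by nlinarith [mul_pos (pow_pos ht 2) hR])]
    congr 1
    rw [show t * R - -(t * R) = 2 * (t * R) by ring, mul_pow, mul_pow]
    ring
  rw [hset, hμ, Measure.smul_apply, hvol, smul_eq_mul, ← ENNReal.ofReal_mul hk0]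
  refine ENNReal.ofReal_le_ofReal ?_
  have : 0 ≤ 2 ^ m * (R ^ (m + 1) * t ^ (m + 2)) := by positivity
  rw [show m + 1 + 1 = m + 2 from rfl]
  linarith

/-- A distribution with density bounded away from zero on the body has the body as its support: the
segment from any point of the body to `0` enters the relatively open set `φ < c` immediately. -/
theorem IsRollingSublevel.support_eq_body {d D : ℕ} {φ : EuclideanSpace ℝ (Fin D) → ℝ}
    {G : EuclideanSpace ℝ (Fin D) → EuclideanSpace ℝ (Fin D)} {c ρ : ℝ}
    (h : IsRollingSublevel d φ G c ρ) (hD : d ≤ D) {f : EuclideanSpace ℝ (Fin D) → ℝ}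
    {m : ℝ} (hm : 0 < m) (hf : ∀ x, m ≤ f x) :
    (((hausdorffVolume d D).restrict (body d φ c)).withDensity
      fun x => ENNReal.ofReal (f x)).support = body d φ c := by
  set P := ((hausdorffVolume d D).restrict (body d φ c)).withDensity
    fun x => ENNReal.ofReal (f x) with hP
  have hmeas := h.isClosed_body.measurableSet
  refine Subset.antisymm (Measure.support_subset_of_isClosed h.isClosed_body ?_) fun x hx => ?_
  · exact (withDensity_absolutelyContinuous _ _).ae_le (ae_restrict_mem hmeas)
  · rw [Measure.mem_support_iff_forall]
    intro U hU
    obtain ⟨V, hVU, hV, hxV⟩ := mem_nhds_iff.1 hU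
    have hcont : ContinuousAt (fun t : ℝ => x + t • (0 - x)) 0 := by fun_prop
    have hev := hcont.eventually_mem (hV.mem_nhds (by simpa using hxV))
    have hev' : ∀ᶠ t in 𝓝[>] (0 : ℝ), x + t • (0 - x) ∈ V := nhdsWithin_le_nhds hev
    obtain ⟨t, htV, ht⟩ := (hev'.and (Ioo_mem_nhdsGT one_pos)).exists
    set y := x + t • (0 - x) with hy
    have hyx : y = (1 - t) • x + t • (0 : EuclideanSpace ℝ (Fin D)) := by
      rw [hy]; module
    have hyF : y ∈ flat d D := by
      rw [hyx, smul_zero, add_zero]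
      exact (flatSubmodule d D).smul_mem _ hx.1
    have hyc : φ y < c := by
      have h1 := h.convexOn.2 (mem_univ x) (mem_univ 0) (by linarith [ht.2] : 0 ≤ 1 - t) ht.1.le
        (by ring)
      rw [← hyx, smul_eq_mul, smul_eq_mul] at h1
      have h2 := mul_le_mul_of_nonneg_left hx.2 (by linarith [ht.2] : 0 ≤ 1 - t)
      have h3 := mul_lt_mul_of_pos_left h.zero_lt ht.1
      linarith
    set W := V ∩ {z | φ z < c} with hW
    have hWo : IsOpen W := hV.inter (isOpen_lt h.continuous continuous_const)
    have hpos := hausdorffVolume_inter_flat_pos hD hWo ⟨y, ⟨htV, hyc⟩, hyF⟩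
    have hWm : MeasurableSet (W ∩ flat d D) :=
      hWo.measurableSet.inter (isClosed_flat d D).measurableSet
    have hWb : W ∩ flat d D ⊆ body d φ c := fun z hz => ⟨hz.2, le_of_lt hz.1.2⟩
    calc 0 < ENNReal.ofReal m * hausdorffVolume d D (W ∩ flat d D) :=
          ENNReal.mul_pos (ENNReal.ofReal_pos.2 hm).ne' hpos.ne'
      _ = ∫⁻ _ in W ∩ flat d D, ENNReal.ofReal m ∂(hausdorffVolume d D).restrict (body d φ c) := by
          rw [setLIntegral_const, Measure.restrict_apply hWm, inter_eq_left.2 hWb]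
      _ ≤ P (W ∩ flat d D) := by
          rw [hP, withDensity_apply _ hWm]
          exact lintegral_mono fun z => ENNReal.ofReal_le_ofReal (hf z)
      _ ≤ P U := measure_mono fun z hz => hVU hz.1.1

/-! ### The two-point lower bound -/

/-- The `n`-sample distribution of a conditioned distribution is dominated, up to a factor, by the
`n`-sample distribution of the unconditioned one. -/
theorem pow_smul_pi_cond_le {Ω : Type*} [MeasurableSpace Ω] (P : Measure Ω)
    [IsProbabilityMeasure P] {S : Set Ω} (hPS : P S ≠ 0) (n : ℕ) :
    (P S) ^ n • (Measure.pi fun _ : Fin n => ProbabilityTheory.cond P S) ≤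
      Measure.pi fun _ : Fin n => P := by
  have : IsProbabilityMeasure (ProbabilityTheory.cond P S) :=
    ProbabilityTheory.cond_isProbabilityMeasure hPS
  have h1 : (Measure.pi fun _ : Fin n => ProbabilityTheory.cond P S) =
      ((P S)⁻¹) ^ n • (Measure.pi fun _ : Fin n => P).restrict (univ.pi fun _ => S) := by
    refine Measure.pi_eq fun s hs => ?_
    rw [Measure.smul_apply, Measure.restrict_pi_pi, Measure.pi_pi]
    simp only [ProbabilityTheory.cond, Measure.smul_apply, smul_eq_mul, Finset.prod_mul_distrib,
      Finset.prod_const, Finset.card_univ, Fintype.card_fin]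
  rw [h1, smul_smul, ← mul_pow, ENNReal.mul_inv_cancel hPS (measure_ne_top P S), one_pow, one_smul]
  exact Measure.restrict_le_self

/-- The sum of the risks under both hypotheses, when the losses cannot both be small and the
`n`-sample mass of the conditioning event is at least one half. -/
theorem half_le_lintegral_add_lintegral_cond {Ω : Type*} [MeasurableSpace Ω] (P : Measure Ω)
    [IsProbabilityMeasure P] {S : Set Ω} {n : ℕ} (hPS : 1 / 2 ≤ (P S) ^ n) (hn : n ≠ 0)
    {f g : (Fin n → Ω) → ℝ≥0∞} (hf : Measurable f) {Δ : ℝ≥0∞} (hΔ : ∀ x, Δ ≤ f x + g x) :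
    Δ / 2 ≤ (∫⁻ x, f x ∂Measure.pi fun _ : Fin n => P) +
      ∫⁻ x, g x ∂Measure.pi fun _ : Fin n => ProbabilityTheory.cond P S := by
  have hPS0 : P S ≠ 0 := by
    intro h0
    rw [h0, zero_pow hn] at hPS
    simp at hPS
  have : IsProbabilityMeasure (ProbabilityTheory.cond P S) :=
    ProbabilityTheory.cond_isProbabilityMeasure hPS0
  set Q := Measure.pi fun _ : Fin n => ProbabilityTheory.cond P S
  calc Δ / 2 = 1 / 2 * ∫⁻ _, Δ ∂Q := by
        rw [lintegral_const, measure_univ, mul_one, ENNReal.div_eq_inv_mul, one_div]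
    _ ≤ 1 / 2 * ∫⁻ x, f x + g x ∂Q := by gcongr with x; exact hΔ x
    _ = 1 / 2 * ∫⁻ x, f x ∂Q + 1 / 2 * ∫⁻ x, g x ∂Q := by
        rw [lintegral_add_left hf, mul_add]
    _ ≤ (P S) ^ n * ∫⁻ x, f x ∂Q + 1 * ∫⁻ x, g x ∂Q := by
        gcongr
        simp
    _ = ∫⁻ x, f x ∂((P S) ^ n • Q) + ∫⁻ x, g x ∂Q := by
        rw [lintegral_smul_measure, one_mul, smul_eq_mul]
    _ ≤ _ := by
        gcongr
        exact pow_smul_pi_cond_le P hPS0 n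

/-- Le Cam's two-point bound for a distribution and its conditioning on an event. -/
theorem le_boundaryMinimaxRisk_of_cond {d D n : ℕ} {τmin τbd : ℝ≥0∞} {fmin fmax : ℝ} (hn : n ≠ 0)
    {P : Measure (EuclideanSpace ℝ (Fin D))} [IsProbabilityMeasure P]
    {S : Set (EuclideanSpace ℝ (Fin D))} (hPS : 1 / 2 ≤ (P S) ^ n)
    (hP : P ∈ statisticalModel d D τmin τbd fmin fmax)
    (hP' : ProbabilityTheory.cond P S ∈ statisticalModel d D τmin τbd fmin fmax)
    (hK : IsCompact (boundary d P.support)) (hne : (boundary d P.support).Nonempty)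
    (hne' : (boundary d (ProbabilityTheory.cond P S).support).Nonempty) {Δ : ℝ≥0∞}
    (hΔ : Δ ≤ Metric.hausdorffEDist (boundary d P.support)
      (boundary d (ProbabilityTheory.cond P S).support)) :
    Δ / 4 ≤ boundaryMinimaxRisk d D n τmin τbd fmin fmax := by
  refine le_iInf₂ fun B hB => ?_
  set s := ⨆ (P : Measure (EuclideanSpace ℝ (Fin D)))
      (_ : P ∈ statisticalModel d D τmin τbd fmin fmax)
      (_ : (boundary d P.support).Nonempty), boundaryRisk d P B with hs
  have h1 : boundaryRisk d P B ≤ s := by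
    rw [hs]
    exact le_iSup_of_le P (le_iSup_of_le hP (le_iSup_of_le hne le_rfl))
  have h2 : boundaryRisk d (ProbabilityTheory.cond P S) B ≤ s := by
    rw [hs]
    exact le_iSup_of_le _ (le_iSup_of_le hP' (le_iSup_of_le hne' le_rfl))
  have h3 : Δ / 2 ≤ s + s := by
    refine (half_le_lintegral_add_lintegral_cond P hPS hn (hB _ hK hne) fun x => ?_).trans
      (add_le_add h1 h2)
    refine hΔ.trans ((Metric.hausdorffEDist_triangle (t := B x)).trans_eq ?_)
    rw [Metric.hausdorffEDist_comm (s := B x)]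
  have h4 : Δ / 4 = Δ / 2 / 2 := by
    rw [ENNReal.div_eq_inv_mul, ENNReal.div_eq_inv_mul, ENNReal.div_eq_inv_mul, ← mul_assoc,
      ← ENNReal.mul_inv (by simp) (by simp)]
    norm_num
  rw [h4]
  refine ENNReal.div_le_of_le_mul ?_
  rwa [mul_two]

/-! ### The two hypotheses -/

theorem IsRollingSublevel.withDensity_mem_statisticalModel {d D : ℕ}
    {φ : EuclideanSpace ℝ (Fin D) → ℝ}
    {G : EuclideanSpace ℝ (Fin D) → EuclideanSpace ℝ (Fin D)} {c ρ : ℝ}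
    (h : IsRollingSublevel d φ G c ρ) (hd : 1 ≤ d) (hD : d ≤ D) {fmin fmax : ℝ} (hfmin : 0 < fmin)
    {f : EuclideanSpace ℝ (Fin D) → ℝ} (hfm : Measurable f) (hf : ∀ x, fmin ≤ f x)
    (hf' : ∀ x, f x ≤ fmax) (τmin : ℝ≥0∞)
    (hP : IsProbabilityMeasure (((hausdorffVolume d D).restrict (body d φ c)).withDensity
      fun x => ENNReal.ofReal (f x))) :
    ((hausdorffVolume d D).restrict (body d φ c)).withDensity (fun x => ENNReal.ofReal (f x)) ∈
      statisticalModel d D τmin (ENNReal.ofReal ρ) fmin fmax := by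
  have hsupp := h.support_eq_body hD hfmin hf
  refine ⟨hP, ?_, f, hfm, fun x _ => ⟨hf x, hf' x⟩, ?_⟩
  · rw [hsupp]
    exact h.body_mem_geometricModel hd hD τmin
  · rw [hsupp]

section Bodies

variable {d D : ℕ} {R t : ℝ} {a : EuclideanSpace ℝ (Fin D)}

theorem body_bumpedSq_zero (hR : 0 ≤ R) {s : ℝ} :
    body d (bumpedSq 0 s a) (R ^ 2) = Metric.closedBall 0 R ∩ flat d D := by
  ext x
  rw [inter_comm]
  refine and_congr_right fun _ => ?_
  rw [bumpedSq_zero_left, mem_closedBall_zero_iff, sq_le_sq₀ (norm_nonneg x) hR]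

theorem body_bumpedSq_subset {η : ℝ} (hη : 0 ≤ η) {s : ℝ} :
    body d (bumpedSq η s a) (R ^ 2) ⊆ body d (bumpedSq 0 s a) (R ^ 2) := by
  intro x hx
  refine ⟨hx.1, ?_⟩
  rw [bumpedSq_zero_left]
  exact (sq_le_bumpedSq hη x).trans hx.2

theorem diff_subset_ball {s : ℝ} (hs : 0 < s) {η : ℝ} {x : EuclideanSpace ℝ (Fin D)}
    (hx : x ∈ body d (bumpedSq 0 s a) (R ^ 2) \ body d (bumpedSq η s a) (R ^ 2)) :
    ‖x - a‖ < s := by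
  by_contra! hxs
  refine hx.2 ⟨hx.1.1, ?_⟩
  rw [bumpedSq_of_le_norm hs hxs, ← bumpedSq_zero_left (s := s) (a := a)]
  exact hx.1.2

/-- The opposite ball of radius `R / 2` is not affected by the bump. -/
theorem closedBall_inter_flat_subset_body {η : ℝ} (ht : 0 < t) (ht1 : t ≤ 1) (hR : 0 < R)
    (haR : ‖a‖ = R) :
    Metric.closedBall (-(1 / 2 : ℝ) • a) (R / 2) ∩ flat d D ⊆
      body d (bumpedSq η (t * R) a) (R ^ 2) := by
  rintro x ⟨hx, hxF⟩
  refine ⟨hxF, ?_⟩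
  rw [mem_closedBall_iff_norm] at hx
  have h1 : ‖(-(1 / 2 : ℝ)) • a‖ = R / 2 := by
    rw [norm_smul, haR]; norm_num; ring
  have h2 : ‖x‖ ≤ R := by
    have := norm_le_norm_sub_add x (-(1 / 2 : ℝ) • a)
    linarith
  have h3 : R ≤ ‖x - a‖ := by
    have h4 : a - -(1 / 2 : ℝ) • a = (3 / 2 : ℝ) • a := by module
    have h5 := norm_sub_le_norm_sub_add_norm_sub a x (-(1 / 2 : ℝ) • a)
    rw [h4, norm_smul, haR, norm_sub_rev a x] at h5
    norm_num at h5 hx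
    linarith
  rw [bumpedSq_of_le_norm (by positivity) ((mul_le_of_le_one_left hR.le ht1).trans h3)]
  exact pow_le_pow_left₀ (norm_nonneg x) h2 2

/-- The removed cap `M₀ \ M₁` lies in a box whose height is of the order of the square of its
width. -/
theorem diff_subset_image_box (hd : 1 ≤ d) (hD : d ≤ D) {η : ℝ} (hη : 0 ≤ η) (hη1 : η ≤ 1)
    (ht : 0 < t) (hR : 0 < R)
    (ha : a = EuclideanSpace.single ⟨0, by omega⟩ R) :
    body d (bumpedSq 0 (t * R) a) (R ^ 2) \ body d (bumpedSq η (t * R) a) (R ^ 2) ⊆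
      flatEmbedding hD '' {x | ∀ i : Fin d,
        if (i : ℕ) = 0 then x i ∈ Icc (R - t ^ 2 * R) R else x i ∈ Icc (-(t * R)) (t * R)} := by
  intro x hx
  have hs : 0 < t * R := mul_pos ht hR
  have hxa := diff_subset_ball hs hx
  have hxR : ‖x‖ ^ 2 ≤ R ^ 2 := by
    have := hx.1.2
    rwa [bumpedSq_zero_left] at this
  have hxR' : R ^ 2 < ‖x‖ ^ 2 + (t * R) ^ 2 := by
    have h1 : R ^ 2 < bumpedSq η (t * R) a x := by
      by_contra! h1
      exact hx.2 ⟨hx.1.1, h1⟩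
    have h2 := bumpedSq_le (s := t * R) (a := a) hη x
    nlinarith [sq_nonneg (t * R)]
  obtain ⟨y, rfl⟩ : x ∈ range (flatEmbedding hD) := by
    rw [range_flatEmbedding]
    exact hx.1.1
  refine ⟨y, fun i => ?_, rfl⟩
  set x := flatEmbedding hD y with hxy
  have hyi : y i = x (Fin.castLE hD i) := by
    rw [hxy, flatEmbedding_apply]
    simp
  rw [hyi]
  split_ifs with hi
  · have hi0 : Fin.castLE hD i = ⟨0, by omega⟩ := Fin.ext hi
    have h1 := norm_sub_sq_real x a
    have h2 : ⟪x, a⟫_ℝ = R * x ⟨0, by omega⟩ := by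
      rw [ha, EuclideanSpace.inner_single_right]
      simp
    have h3 : ‖a‖ = R := by
      rw [ha, PiLp.norm_single, Real.norm_of_nonneg hR.le]
    rw [h2, h3] at h1
    have h4 := pow_lt_pow_left₀ hxa (norm_nonneg _) two_ne_zero
    rw [hi0]
    constructor
    · have h5 : R * (R - t ^ 2 * R) ≤ R * x ⟨0, by omega⟩ := by nlinarith
      exact le_of_mul_le_mul_left h5 hR
    · have h5 := (Real.le_norm_self _).trans (PiLp.norm_apply_le x ⟨0, by omega⟩)
      exact h5.trans ((sq_le_sq₀ (norm_nonneg _) hR.le).1 hxR)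
  · have h1 : x (Fin.castLE hD i) = (x - a) (Fin.castLE hD i) := by
      have h2 : Fin.castLE hD i ≠ ⟨0, by omega⟩ := fun h => hi (congrArg Fin.val h)
      rw [ha]
      simp [h2]
    rw [h1]
    exact abs_le.1 ((PiLp.norm_apply_le (x - a) _).trans hxa.le)

theorem le_edist_of_mem_body (ht : 0 < t) (ht1 : t ≤ 1) (hR : 0 < R) (haR : ‖a‖ = R)
    {x : EuclideanSpace ℝ (Fin D)} (hx : x ∈ body d (bumpedSq (1 / 24) (t * R) a) (R ^ 2)) :
    ENNReal.ofReal (t ^ 2 * R / 192) ≤ edist a x := by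
  rw [edist_dist, dist_eq_norm]
  refine ENNReal.ofReal_le_ofReal ?_
  rw [norm_sub_rev]
  have hs : 0 < t * R := mul_pos ht hR
  by_cases hxs : ‖x - a‖ ≤ t * R / 2
  · have h1 : 1 / 4 ≤ bump ((t * R)⁻¹ • (x - a)) := by
      refine le_bump ?_
      rw [norm_smul, norm_inv, Real.norm_of_nonneg hs.le, inv_mul_le_iff₀ hs]
      linarith
    have h2 := hx.2
    rw [bumpedSq] at h2
    have h3 : ‖x‖ ^ 2 + 1 / 96 * (t * R) ^ 2 ≤ R ^ 2 := by
      nlinarith [sq_nonneg (t * R)]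
    have h4 := norm_sub_norm_le a x
    rw [haR, norm_sub_rev] at h4
    have h5 : ‖x‖ ≤ R := by
      rw [← sq_le_sq₀ (norm_nonneg x) hR.le]
      nlinarith [sq_nonneg (t * R)]
    -- `R² - |x|² = (R - |x|) (R + |x|) ≤ 2 R (R - |x|)`
    have h6 : R * (t ^ 2 * R / 192) ≤ R * (R - ‖x‖) := by
      nlinarith [sq_nonneg (R - ‖x‖)]
    exact (le_of_mul_le_mul_left h6 hR).trans h4
  · have h1 : t ^ 2 * R ≤ t * R := by nlinarith
    linarith

end Bodies

/-- If the removed cap carries mass at most `1 / (2 n)`, then the uniform distribution on the ball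
(with additional mass in a smaller ball away from the cap) and its conditioning on the complement of
the cap cannot be told apart from `n` observations. -/
theorem le_boundaryMinimaxRisk_of_cap {d D n : ℕ} (hd : 1 ≤ d) (hD : d ≤ D) (hn : 1 ≤ n)
    {K : ℝ} (hK : ∀ R t : ℝ, 0 < R → 0 < t → hausdorffVolume d d {x | ∀ i : Fin d,
      if (i : ℕ) = 0 then x i ∈ Icc (R - t ^ 2 * R) R else x i ∈ Icc (-(t * R)) (t * R)} ≤
        ENNReal.ofReal (K * (R ^ d * t ^ (d + 1))))
    (τmin : ℝ≥0∞) {R t fmin fmax : ℝ} (hR : 0 < R) (ht : 0 < t) (ht1 : t ≤ 1) (hfmin : 0 < fmin)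
    (hmass : fmin * (unitBallVolume d * R ^ d) ≤ 1 / 2)
    (hfmax : 4 * (2 ^ d / (unitBallVolume d * R ^ d)) ≤ fmax)
    (hcap : fmin * (K * (R ^ d * t ^ (d + 1))) ≤ 1 / (2 * n)) :
    ENNReal.ofReal (t ^ 2 * R / 768) ≤
      boundaryMinimaxRisk d D n τmin (ENNReal.ofReal (R / 2)) fmin fmax := by
  set a : EuclideanSpace ℝ (Fin D) := EuclideanSpace.single ⟨0, by omega⟩ R with ha
  have haR : ‖a‖ = R := by
    rw [ha, PiLp.norm_single, Real.norm_of_nonneg hR.le]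
  have haF : a ∈ flat d D := by
    intro i hi
    have : i ≠ ⟨0, by omega⟩ := fun h => by
      rw [h] at hi
      simp at hi
      omega
    rw [ha]
    simp [this]
  have hs : 0 < t * R := mul_pos ht hR
  have hsR : t * R ≤ R := mul_le_of_le_one_left hR.le ht1
  have h0 : IsRollingSublevel d (bumpedSq 0 (t * R) a) _ (R ^ 2) (R / 2) :=
    isRollingSublevel_bumpedSq le_rfl (by norm_num) hs hsR haF
  have h1 : IsRollingSublevel d (bumpedSq (1 / 24) (t * R) a) _ (R ^ 2) (R / 2) :=
    isRollingSublevel_bumpedSq (by norm_num) le_rfl hs hsR haF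
  set M₀ := body d (bumpedSq 0 (t * R) a) (R ^ 2) with hM₀
  set M₁ := body d (bumpedSq (1 / 24) (t * R) a) (R ^ 2) with hM₁
  have hM : M₁ ⊆ M₀ := body_bumpedSq_subset (by norm_num)
  have hm₀ : MeasurableSet M₀ := h0.isClosed_body.measurableSet
  have hm₁ : MeasurableSet M₁ := h1.isClosed_body.measurableSet
  set Q := Metric.closedBall (-(1 / 2 : ℝ) • a) (R / 2) ∩ flat d D with hQ
  have hQM : Q ⊆ M₁ := closedBall_inter_flat_subset_body ht ht1 hR haR
  have hmQ : MeasurableSet Q := Metric.isClosed_closedBall.measurableSet.inter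
    (isClosed_flat d D).measurableSet
  have hκ := unitBallVolume_pos d
  set κ := unitBallVolume d
  have hκR : 0 < κ * R ^ d := by positivity
  have hvM₀ : hausdorffVolume d D M₀ = ENNReal.ofReal (κ * R ^ d) := by
    rw [hM₀, body_bumpedSq_zero hR.le]
    exact hausdorffVolume_closedBall hD (flatSubmodule d D).zero_mem hR.le
  have hvQ : hausdorffVolume d D Q = ENNReal.ofReal (κ * (R / 2) ^ d) :=
    hausdorffVolume_closedBall hD ((flatSubmodule d D).smul_mem _ haF) (by positivity)
  -- the additional density on `Q`, such that the total mass is one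
  set A : ℝ := (1 - fmin * (κ * R ^ d)) / (κ * (R / 2) ^ d) with hA
  have hA0 : 0 ≤ A := div_nonneg (by linarith) (by positivity)
  have hA1 : fmin + A ≤ 2 * (2 ^ d / (κ * R ^ d)) := by
    have h2 : A ≤ 2 ^ d / (κ * R ^ d) := by
      rw [hA, div_pow, div_le_div_iff₀ (by positivity) hκR]
      have : 2 ^ d * (κ * (R ^ d / 2 ^ d)) = κ * R ^ d := by field_simp
      rw [this]
      exact mul_le_of_le_one_left hκR.le (by linarith [mul_pos hfmin hκR])
    have h3 : fmin ≤ 2 ^ d / (κ * R ^ d) := by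
      rw [le_div_iff₀ hκR]
      have : (1 : ℝ) ≤ 2 ^ d := one_le_pow₀ one_le_two
      linarith
    linarith
  set f : EuclideanSpace ℝ (Fin D) → ℝ := fun x => fmin + Q.indicator (fun _ => A) x with hf
  have hfm : Measurable f := measurable_const.add (measurable_const.indicator hmQ)
  have hf0 : ∀ x, fmin ≤ f x := fun x =>
    le_add_of_nonneg_right (indicator_nonneg (fun _ _ => hA0) x)
  have hf1 : ∀ x, f x ≤ fmin + A := fun x =>
    add_le_add_right (indicator_le_self' (fun _ _ => hA0) x) _
  have hfQ : ∀ x ∉ Q, f x = fmin := fun x hx => by simp [hf, hx]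
  set P := ((hausdorffVolume d D).restrict M₀).withDensity fun x => ENNReal.ofReal (f x) with hP
  have hfE : ∀ x, ENNReal.ofReal (f x) =
      ENNReal.ofReal fmin + Q.indicator (fun _ => ENNReal.ofReal A) x := by
    intro x
    by_cases hx : x ∈ Q
    · simp only [hf, indicator_of_mem hx]
      exact ENNReal.ofReal_add hfmin.le hA0
    · simp [hf, hx]
  have hPprob : IsProbabilityMeasure P := by
    constructor
    rw [hP, withDensity_apply _ MeasurableSet.univ, Measure.restrict_univ]
    simp only [hfE]
    rw [lintegral_add_left measurable_const, setLIntegral_const, lintegral_indicator hmQ,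
      setLIntegral_const, Measure.restrict_apply hmQ, inter_eq_left.2 (hQM.trans hM), hvM₀, hvQ,
      ← ENNReal.ofReal_mul hfmin.le, ← ENNReal.ofReal_mul hA0,
      ← ENNReal.ofReal_add (by positivity) (by positivity), hA, div_mul_cancel₀ _ (by positivity)]
    simp
  have hPM₀ : P M₀ = 1 := by
    rw [← prob_compl_eq_zero_iff hm₀, hP]
    refine withDensity_absolutelyContinuous _ _ ?_
    rw [Measure.restrict_apply hm₀.compl, compl_inter_self, measure_empty]
  have hPdiff : P (M₀ \ M₁) ≤ ENNReal.ofReal (1 / (2 * n)) := by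
    have hmd := hm₀.diff hm₁
    rw [hP, withDensity_apply _ hmd, Measure.restrict_restrict hmd,
      inter_eq_left.2 sdiff_subset]
    calc ∫⁻ x in M₀ \ M₁, ENNReal.ofReal (f x) ∂hausdorffVolume d D
        = ∫⁻ _ in M₀ \ M₁, ENNReal.ofReal fmin ∂hausdorffVolume d D :=
          setLIntegral_congr_fun hmd fun x hx => by
            simp only [hfQ x fun hxQ => hx.2 (hQM hxQ)]
      _ = ENNReal.ofReal fmin * hausdorffVolume d D (M₀ \ M₁) := setLIntegral_const _ _
      _ ≤ ENNReal.ofReal fmin * ENNReal.ofReal (K * (R ^ d * t ^ (d + 1))) := by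
          gcongr
          refine (measure_mono (diff_subset_image_box hd hD (by norm_num) (by norm_num)
            ht hR ha)).trans ?_
          rw [hausdorffVolume_image]
          exact hK R t hR ht
      _ ≤ ENNReal.ofReal (1 / (2 * n)) := by
          rw [← ENNReal.ofReal_mul hfmin.le]
          exact ENNReal.ofReal_le_ofReal hcap
  have hn0 : (1 : ℝ) ≤ n := by exact_mod_cast hn
  set q := (P M₁).toReal with hq
  have hPq : P M₁ = ENNReal.ofReal q := (ENNReal.ofReal_toReal (measure_ne_top P M₁)).symm
  have hqn : 1 - 1 / (2 * (n : ℝ)) ≤ q := by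
    have h2 : (1 : ℝ≥0∞) ≤ ENNReal.ofReal (1 / (2 * n)) + P M₁ := by
      rw [← hPM₀, ← measure_sdiff_add_inter M₀ hm₁, inter_eq_right.2 hM]
      exact add_le_add_left hPdiff _
    rw [hPq, ← ENNReal.ofReal_add (by positivity) ENNReal.toReal_nonneg,
      ENNReal.one_le_ofReal] at h2
    linarith
  have hqhalf : 1 / 2 ≤ q := by
    have : 1 / (2 * (n : ℝ)) ≤ 1 / 2 := by
      apply one_div_le_one_div_of_le <;> linarith
    linarith
  have hq0 : 0 < q := by linarith
  have hqone : q ≤ 1 := by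
    rw [hq]
    exact ENNReal.toReal_le_of_le_ofReal zero_le_one (by simpa using prob_le_one)
  have hpow : 1 / 2 ≤ (P M₁) ^ n := by
    have h2 : -2 ≤ -(1 / (2 * (n : ℝ))) := by
      have : 1 / (2 * (n : ℝ)) ≤ 1 / 2 := by
        apply one_div_le_one_div_of_le <;> linarith
      linarith
    have h3 := one_add_mul_le_pow h2 n
    have h4 : (1 : ℝ) + n * -(1 / (2 * (n : ℝ))) = 1 / 2 := by
      field_simp
      norm_num
    have h5 : (1 / 2 : ℝ) ≤ q ^ n := by
      rw [← h4]
      refine h3.trans (pow_le_pow_left₀ ?_ (by linarith) n)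
      have : 1 / (2 * (n : ℝ)) ≤ 1 / 2 := by
        apply one_div_le_one_div_of_le <;> linarith
      linarith
    rw [hPq, ← ENNReal.ofReal_pow hq0.le]
    calc (1 / 2 : ℝ≥0∞) = ENNReal.ofReal (1 / 2) := by
          rw [ENNReal.ofReal_div_of_pos two_pos]; simp
      _ ≤ _ := ENNReal.ofReal_le_ofReal h5
  have hcond : ProbabilityTheory.cond P M₁ = ((hausdorffVolume d D).restrict M₁).withDensity
      fun x => ENNReal.ofReal (q⁻¹ * f x) := by
    have h2 : (fun x => ENNReal.ofReal (q⁻¹ * f x)) =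
        ENNReal.ofReal q⁻¹ • fun x => ENNReal.ofReal (f x) := by
      ext x
      rw [ENNReal.ofReal_mul (inv_nonneg.2 hq0.le)]
      rfl
    rw [h2, withDensity_smul _ hfm.ennreal_ofReal, ProbabilityTheory.cond, hP,
      restrict_withDensity hm₁, Measure.restrict_restrict hm₁, inter_eq_left.2 hM, ← hP, hPq,
      ENNReal.ofReal_inv_of_pos hq0]
  have hg0 : ∀ x, fmin ≤ q⁻¹ * f x := fun x =>
    (hf0 x).trans (le_mul_of_one_le_left (hfmin.le.trans (hf0 x)) ((one_le_inv₀ hq0).2 hqone))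
  have hg1 : ∀ x, q⁻¹ * f x ≤ fmax := fun x => by
    have h2 : q⁻¹ ≤ 2 := by
      rw [inv_le_comm₀ hq0 two_pos]
      linarith
    have h3 := mul_le_mul h2 ((hf1 x).trans hA1) (hfmin.le.trans (hf0 x)) zero_le_two
    linarith
  have hPM₁ : P M₁ ≠ 0 := by
    rw [hPq]
    exact (ENNReal.ofReal_pos.2 hq0).ne'
  have hcondprob := ProbabilityTheory.cond_isProbabilityMeasure hPM₁
  have hs₀ : boundary d P.support = shell d (bumpedSq 0 (t * R) a) (R ^ 2) := by
    rw [hP, h0.support_eq_body hD hfmin hf0, h0.boundary_body hd hD]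
  have hs₁ : boundary d (ProbabilityTheory.cond P M₁).support =
      shell d (bumpedSq (1 / 24) (t * R) a) (R ^ 2) := by
    rw [hcond, h1.support_eq_body hD hfmin hg0, h1.boundary_body hd hD]
  have ha₀ : a ∈ shell d (bumpedSq 0 (t * R) a) (R ^ 2) :=
    ⟨haF, by rw [bumpedSq_zero_left, haR]⟩
  have ha₁ : -a ∈ shell d (bumpedSq (1 / 24) (t * R) a) (R ^ 2) := by
    refine ⟨(flatSubmodule d D).neg_mem haF, ?_⟩
    rw [bumpedSq_of_le_norm hs, norm_neg, haR]
    have : -a - a = (-2 : ℝ) • a := by module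
    rw [this, norm_smul, haR]
    norm_num
    linarith
  have h768 : ENNReal.ofReal (t ^ 2 * R / 768) = ENNReal.ofReal (t ^ 2 * R / 192) / 4 := by
    have : t ^ 2 * R / 768 = t ^ 2 * R / 192 / 4 := by ring
    rw [this, ENNReal.ofReal_div_of_pos (by norm_num)]
    norm_num
  rw [h768]
  refine le_boundaryMinimaxRisk_of_cond (by omega) hpow ?_ ?_ ?_ ?_ ?_ ?_
  · refine h0.withDensity_mem_statisticalModel hd hD hfmin hfm hf0 (fun x => ?_) τmin hPprob
    have := (hf1 x).trans hA1
    have : 0 < 2 ^ d / (κ * R ^ d) := by positivity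
    linarith
  · rw [hcond] at hcondprob ⊢
    exact h1.withDensity_mem_statisticalModel hd hD hfmin (hfm.const_mul _) hg0 hg1 τmin hcondprob
  · rw [hs₀]
    exact h0.isCompact_shell
  · rw [hs₀]
    exact ⟨a, ha₀⟩
  · rw [hs₁]
    exact ⟨-a, ha₁⟩
  · rw [hs₀, hs₁]
    refine le_trans ?_ (Metric.infEDist_le_hausdorffEDist_of_mem ha₀)
    exact Metric.le_infEDist.2 fun x hx =>
      le_edist_of_mem_body ht ht1 hR haR (IsRollingSublevel.shell_subset_body hx)

end BoundaryEstimation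

theorem mainTheorem3 (d : ℕ) (hd : 1 ≤ d) :
    ∃ c c' C : ℝ, 0 < c ∧ 0 < c' ∧ 0 < C ∧
      ∀ (D : ℕ), d ≤ D →
      ∀ (τmin : ℝ≥0∞) (τbd fmin fmax : ℝ), 0 < τmin → 0 < τbd → 0 < fmin → fmin ≤ fmax →
        fmin ≤ c / τbd ^ d → c' / τbd ^ d ≤ fmax →
      ∀ (n : ℕ), 1 ≤ n →
        ENNReal.ofReal
            (C * τbd * min 1 ((1 / (fmin * τbd ^ d * (n : ℝ))) ^ ((2 : ℝ) / ((d : ℝ) + 1)))) ≤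
          BoundaryEstimation.boundaryMinimaxRisk d D n τmin (ENNReal.ofReal τbd) fmin fmax := by
  obtain ⟨K, hK0, hK⟩ := BoundaryEstimation.exists_hausdorffVolume_box_le hd
  have hκ := BoundaryEstimation.unitBallVolume_pos d
  set κ := BoundaryEstimation.unitBallVolume d
  set α : ℝ := min 1 (1 / (K * 2 ^ (d + 1))) with hα
  have hα0 : 0 < α := lt_min one_pos (by positivity)
  have hα1 : α ≤ 1 := min_le_left _ _
  have hαK : K * 2 ^ (d + 1) * α ≤ 1 := by
    have h1 : α ≤ 1 / (K * 2 ^ (d + 1)) := min_le_right _ _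
    rw [le_div_iff₀ (by positivity)] at h1
    linarith
  refine ⟨1 / (2 * κ * 2 ^ d), 4 / κ, α ^ 2 / 384, by positivity, by positivity, by positivity,
    fun D hD τmin τbd fmin fmax _ hτ hfmin _ hc hc' n hn => ?_⟩
  have hn0 : (1 : ℝ) ≤ n := by exact_mod_cast hn
  set y : ℝ := 1 / (fmin * τbd ^ d * n) with hy
  have hy0 : 0 < y := by positivity
  have hd0 : (0 : ℝ) < (d : ℝ) + 1 := by positivity
  -- the relative width of the cap
  set z : ℝ := y ^ (1 / ((d : ℝ) + 1)) with hz
  have hz0 : 0 < z := Real.rpow_pos_of_pos hy0 _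
  have hzd : z ^ (d + 1) = y := by
    rw [hz, ← Real.rpow_natCast, ← Real.rpow_mul hy0.le]
    push_cast
    rw [one_div_mul_cancel hd0.ne', Real.rpow_one]
  have hz2 : z ^ 2 = y ^ ((2 : ℝ) / ((d : ℝ) + 1)) := by
    rw [hz, ← Real.rpow_natCast, ← Real.rpow_mul hy0.le]
    congr 1
    push_cast
    ring
  set m : ℝ := min 1 z with hm
  have hm0 : 0 < m := lt_min one_pos hz0
  have hm2 : m ^ 2 = min 1 (y ^ ((2 : ℝ) / ((d : ℝ) + 1))) := by
    rw [← hz2]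
    rcases le_total 1 z with h | h
    · rw [hm, min_eq_left h, min_eq_left (one_le_pow₀ h), one_pow]
    · rw [hm, min_eq_right h, min_eq_right (pow_le_one₀ hz0.le h)]
  have hmd : m ^ (d + 1) ≤ y := hzd ▸ pow_le_pow_left₀ hm0.le (min_le_right _ _) _
  have key := BoundaryEstimation.le_boundaryMinimaxRisk_of_cap hd hD hn hK τmin (R := 2 * τbd)
    (t := α * m) (fmin := fmin) (fmax := fmax) (by positivity) (by positivity)
    (mul_le_one₀ hα1 hm0.le (min_le_left _ _)) hfmin ?_ ?_ ?_
  · rw [mul_div_cancel_left₀ τbd two_ne_zero] at key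
    refine le_trans (ENNReal.ofReal_le_ofReal (le_of_eq ?_)) key
    rw [← hm2]
    ring
  · rw [le_div_iff₀ (by positivity)] at hc
    calc fmin * (κ * (2 * τbd) ^ d) = κ * 2 ^ d * (fmin * τbd ^ d) := by rw [mul_pow]; ring
      _ ≤ κ * 2 ^ d * (1 / (2 * κ * 2 ^ d)) := by gcongr
      _ = 1 / 2 := by field_simp
  · refine le_trans (le_of_eq ?_) hc'
    rw [mul_pow]
    field_simp
    exact div_self hκ.ne'
  · calc fmin * (K * ((2 * τbd) ^ d * (α * m) ^ (d + 1)))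
        = fmin * K * (2 * τbd) ^ d * (α ^ (d + 1) * m ^ (d + 1)) := by rw [mul_pow α]; ring
      _ ≤ fmin * K * (2 * τbd) ^ d * (α * y) := by
          gcongr
          exact pow_le_of_le_one hα0.le hα1 (by omega)
      _ = K * 2 ^ (d + 1) * α * (1 / (2 * n)) := by
          rw [hy, mul_pow]
          field_simp
          ring
      _ ≤ 1 * (1 / (2 * n)) := by gcongr
      _ = 1 / (2 * n) := one_mul _
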